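/- **Theorem 1 (Cold-start MSE under a correct LIP).** *Model.* Fix $d\ge 0$, $\sigma>0$, $\theta_0\in\mathbb R^d$ and a null prior $\phi_{\mathrm{null}}$ (a probability measure on $\mathbb R^d$) with $\bar D^2:=\mathbb E_{\vartheta\sim\phi_{\mathrm{null}}}\|\vartheta-\theta_0\|^2<\infty$. Let $p(x\mid\theta)$ be the density of $\mathcal N(\theta,\sigma^2I)$, $q(x):=\int p(x\mid\vartheta)\,\phi_{\mathrm{null}}(d\vartheta)$ and $\ell(x;\theta):=\log\frac{p(x\mid\theta)}{q(x)}$. There are $K\ge 0$ sources and a set $R\subseteq\{1,\dots,K\}$ of relevant ones. The source parameters are independent, with $\theta_k=\theta_0$ for $k\in R$ and $\theta_k\sim\phi_{\mathrm{null}}$ for $k\notin R$. Given $\{\theta_k\}$, all observations are independent: $N_0\ge1$ target samples from $\mathcal N(\theta_0,\sigma^2I)$ and, for each $k$, $N\ge1$ samples $x^{(k)}_i$ from $p_k:=\mathcal N(\theta_k,\sigma^2I)$. Let $\hat\theta_0,\hat\theta_1,\dots,\hat\theta_K$ be the sample means and $\rho_k(\theta):=\mathbb E_{x\sim p_k}\ell(x;\theta)$.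 *Surrogate EM.* For source priors $\pi_k\in(0,1)$, a tempering scalar $\beta>0$ and an initial value $\theta^{(0)}$ that may depend on the data, with the sigmoid $\operatorname{sg}(z)=1/(1+e^{-z})$, $$w_k^{(t)}=\operatorname{sg}\Bigl(\beta\sum_{i=1}^N\ell(x_i^{(k)};\theta^{(t)})+\log\tfrac{\pi_k}{1-\pi_k}\Bigr),\qquad \theta^{(t+1)}=\frac{N_0\hat\theta_0+N\sum_k w_k^{(t)}\hat\theta_k}{N_0+N\sum_k w_k^{(t)}} .$$ *Claim.* There are absolute constants $c_1,c_2,c_3>0$ and, for each model $(d,\sigma,\theta_0,\phi_{\mathrm{null}})$, a constant $C>0$ such that the following holds for all $K,N_0,N,R,\pi,\beta$, all initializations, and all $r_{\mathrm{sep}},V,L,\Delta^*>0$ and $\alpha\in[0,1]$. Assume 1. (regularity) on a neighbourhood of $\theta_0$ that contains the basin $\{\|\theta-\theta_0\|\le c_1\Delta^*/L\}$, for almost every prior draw and every $k$, the variable $\ell(x;\theta)-\rho_k(\theta)$ is sub-Gaussian under $p_k$ with parameter $V^2$ for every $\theta$ in the neighbourhood, and $\rho_k$ is $L$-Lipschitz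 there; 2. (separation) $\mathbb P_{\vartheta\sim\phi_{\mathrm{null}}}(\|\vartheta-\theta_0\|<r_{\mathrm{sep}})\le\alpha$; 3. (identifiability margin) for almost every prior draw with $\|\theta_k-\theta_0\|\ge r_{\mathrm{sep}}$ for all $k\notin R$, one has $\rho_k(\theta_0)\ge\Delta^*$ for $k\in R$ and $\rho_k(\theta_0)\le-\Delta^*$ for $k\notin R$. Let $\mathcal G$ be the event that the iterates $\theta^{(t)}$ enter the basin, remain in it from then on, and converge to $\theta^{(\infty)}$ (which is then a fixed point of the EM step). Then, with probability at least $1-K\alpha$ over the prior draw of $\{\theta_k\}$, $$\mathbb E\Bigl[\|\theta^{(\infty)}-\theta_0\|^2\,\mathbf 1_{\mathcal G}\,\Big|\,\{\theta_k\}\Bigr]\le\frac{2d\sigma^2}{N_0+N|R|}+C_1e^{-c_2\beta N\Delta^*}+C_2e^{-c_3N(\Delta^*)^2/V^2},$$ where, with $B:=\max_k\bigl|\log\frac{\pi_k}{1-\pi_k}\bigr|$, $$C_1=C\,K^2\Bigl(\frac N{N_0}\Bigr)^2\Bigl(\bar D^2+\frac{d\sigma^2}N\Bigr)e^{2B},\qquad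 C_2=C\,K^{5/2}\Bigl(\frac N{N_0}\Bigr)^2\Bigl(\bar D^2+\frac{d\sigma^2}N\Bigr).$$ -/

import Mathlib

open MeasureTheory ProbabilityTheory Filter Topology
open scoped NNReal ENNReal

noncomputable section

namespace ColdStart

/-- Parameters and observations live in `ℝ^d` with the Euclidean norm. -/
abbrev Vec (d : ℕ) : Type := EuclideanSpace ℝ (Fin d)

/-- The law `N(θ, σ² I)` on `ℝ^d`. -/
def gaussLaw {d : ℕ} (σ : ℝ) (θ : Vec d) : Measure (Vec d) :=
  multivariateGaussian θ ((σ ^ 2) • (1 : Matrix (Fin d) (Fin d) ℝ))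

/-- The Lebesgue density `p(x | θ)` of `N(θ, σ² I)`. -/
def gaussDensity {d : ℕ} (σ : ℝ) (θ x : Vec d) : ℝ :=
  (√(2 * Real.pi * σ ^ 2))⁻¹ ^ d * Real.exp (-(‖x - θ‖ ^ 2 / (2 * σ ^ 2)))

/-- The null density `q(x) = ∫ p(x | ϑ) φ_null(dϑ)`. -/
def nullDensity {d : ℕ} (σ : ℝ) (φ : Measure (Vec d)) (x : Vec d) : ℝ :=
  ∫ ϑ, gaussDensity σ ϑ x ∂φ

/-- The per-sample log-likelihood ratio `ℓ(x; θ) = log (p(x | θ) / q(x))`. -/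
def logLR {d : ℕ} (σ : ℝ) (φ : Measure (Vec d)) (θ x : Vec d) : ℝ :=
  Real.log (gaussDensity σ θ x / nullDensity σ φ x)

/-- The expected per-sample log-likelihood ratio at `θ`, for a source with parameter `ϑ`:
`ρ(θ) = E_{x ∼ N(ϑ, σ² I)} ℓ(x; θ)`. -/
def rho {d : ℕ} (σ : ℝ) (φ : Measure (Vec d)) (ϑ θ : Vec d) : ℝ :=
  ∫ x, logLR σ φ θ x ∂(gaussLaw σ ϑ)

/-- The second moment `D̄² = E_{ϑ ∼ φ_null} ‖ϑ - θ₀‖²` of the null prior around `θ₀`. -/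
def nullMoment {d : ℕ} (φ : Measure (Vec d)) (θ₀ : Vec d) : ℝ :=
  ∫ ϑ, ‖ϑ - θ₀‖ ^ 2 ∂φ

/-- The prior law of `(θ_1, …, θ_K)` for the relevant set `R` (with `τ = 0`): independent
coordinates, `θ_k = θ₀` for `k ∈ R` and `θ_k ∼ φ_null` for `k ∉ R`. -/
def priorLaw {d K : ℕ} (φ : Measure (Vec d)) (θ₀ : Vec d) (R : Finset (Fin K)) :
    Measure (Fin K → Vec d) :=
  Measure.pi fun k => if k ∈ R then Measure.dirac θ₀ else φ

/-- The observed data: the target sample (of size `N₀`) and the `K` source samples (of size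
`N` each). -/
abbrev Data (d K N₀ N : ℕ) : Type := (Fin N₀ → Vec d) × (Fin K → Fin N → Vec d)

/-- The conditional law of the data given `(θ_1, …, θ_K)`: all observations are independent, the
target ones with law `N(θ₀, σ² I)` and those of source `k` with law `N(θ_k, σ² I)`. -/
def dataLaw {d K : ℕ} (N₀ N : ℕ) (σ : ℝ) (θ₀ : Vec d) (θ : Fin K → Vec d) :
    Measure (Data d K N₀ N) :=
  (Measure.pi fun _ : Fin N₀ => gaussLaw σ θ₀).prod
    (Measure.pi fun k : Fin K => Measure.pi fun _ : Fin N => gaussLaw σ (θ k))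

/-- The sample mean, which is the maximum likelihood estimator of a Gaussian mean. -/
def sampleMean {d n : ℕ} (x : Fin n → Vec d) : Vec d := (n : ℝ)⁻¹ • ∑ i, x i

/-- The E-step weight of a source with sample `x` and prior relevance probability `p`, at the
current iterate `θ`: `sigmoid (β ∑ᵢ ℓ(xᵢ; θ) + log (p / (1 - p)))`. -/
def emWeight {d N : ℕ} (σ : ℝ) (φ : Measure (Vec d)) (β p : ℝ) (x : Fin N → Vec d) (θ : Vec d) :
    ℝ :=
  Real.sigmoid (β * ∑ i, logLR σ φ θ (x i) + Real.log (p / (1 - p)))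

/-- One step of the surrogate EM iteration: the E-step followed by the precision-weighted average
of the maximum likelihood estimators. -/
def emStep {d K N₀ N : ℕ} (σ : ℝ) (φ : Measure (Vec d)) (β : ℝ) (p : Fin K → ℝ)
    (ω : Data d K N₀ N) (θ : Vec d) : Vec d :=
  ((N₀ : ℝ) + N * ∑ k, emWeight σ φ β (p k) (ω.2 k) θ)⁻¹ •
    ((N₀ : ℝ) • sampleMean ω.1 +
      (N : ℝ) • ∑ k, emWeight σ φ β (p k) (ω.2 k) θ • sampleMean (ω.2 k))

/-- The iterate `θ^(t)` of the surrogate EM iteration started at `θinit`. -/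
def emIterate {d K N₀ N : ℕ} (σ : ℝ) (φ : Measure (Vec d)) (β : ℝ) (p : Fin K → ℝ)
    (ω : Data d K N₀ N) (θinit : Vec d) (t : ℕ) : Vec d :=
  (emStep σ φ β p ω)^[t] θinit

/-- The event that the EM iterates enter the ball of radius `r` around `θ₀`, remain there from
then on, and converge to `θlim`, which is then a fixed point of the EM step. -/
def basinEvent {d K N₀ N : ℕ} (σ : ℝ) (φ : Measure (Vec d)) (β : ℝ) (p : Fin K → ℝ)
    (θ₀ : Vec d) (r : ℝ) (θinit θlim : Data d K N₀ N → Vec d) : Set (Data d K N₀ N) :=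
  {ω | (∃ t₀, ∀ t ≥ t₀, ‖emIterate σ φ β p ω (θinit ω) t - θ₀‖ ≤ r) ∧
    Tendsto (fun t => emIterate σ φ β p ω (θinit ω) t) atTop (𝓝 (θlim ω))}

/-- The well-separated event: every irrelevant source parameter has distance at least `rsep` from
`θ₀`. -/
def wellSeparated {d K : ℕ} (θ₀ : Vec d) (R : Finset (Fin K)) (rsep : ℝ) :
    Set (Fin K → Vec d) :=
  {θ | ∀ k, k ∉ R → rsep ≤ ‖θ k - θ₀‖}

/-- Regularity of the log-likelihood ratio on `U` for the source parameters `θ`: for each source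
it is centred sub-Gaussian with parameter `V²` at every point of `U`, and its expectation is
`L`-Lipschitz on `U`. -/
def RegularOn {d K : ℕ} (σ : ℝ) (φ : Measure (Vec d)) (V L : ℝ≥0) (U : Set (Vec d))
    (θ : Fin K → Vec d) : Prop :=
  ∀ k, (∀ ϑ ∈ U, HasSubgaussianMGF (fun x => logLR σ φ ϑ x - rho σ φ (θ k) ϑ) (V ^ 2)
      (gaussLaw σ (θ k))) ∧
    LipschitzOnWith L (fun ϑ => rho σ φ (θ k) ϑ) U

/-- The classification margin at the truth is at least `Δ`: the expected log-likelihood ratio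
has absolute value at least `Δ`, and its sign tells relevant from irrelevant sources. -/
def HasMargin {d K : ℕ} (σ : ℝ) (φ : Measure (Vec d)) (θ₀ : Vec d) (R : Finset (Fin K)) (Δ : ℝ)
    (θ : Fin K → Vec d) : Prop :=
  ∀ k, (k ∈ R → Δ ≤ rho σ φ (θ k) θ₀) ∧ (k ∉ R → rho σ φ (θ k) θ₀ ≤ -Δ)

/-- `B = max_k |log (π_k / (1 - π_k))|`. -/
def logitBound {K : ℕ} (p : Fin K → ℝ) : ℝ := ⨆ k, |Real.log (p k / (1 - p k))|

end ColdStart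

end

/-! An EM step is a weighted mean. It differs from the oracle mean, which pools the target with
exactly the relevant sources, by a term proportional to the weight errors `w k - 1_R(k)`. The oracle
error is Gaussian with variance `σ² / (N₀ + N |R|)` per coordinate, and `(a + b)² ≤ 2a² + 2b²` turns
it into the leading term with its factor 2. It remains to show that the weights are nearly 0 or 1
throughout the basin, since any step that starts in the basin then obeys the bound, and so does the
limit.

Uniformity over the basin needs no covering argument. For Gaussian densities the null density `q`
cancels from `ℓ(x;θ) - ℓ(x;θ')`, which is affine in `x`; hence the log-likelihood sum at any `θ` is
controlled by the one at `θ₀` and by the sample mean (`abs_sum_logLR_sub_le`). Sub-Gaussianity at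
two parameters also forces their distance to be at most `2Vσ` (`norm_sub_le_of_hasSubgaussianMGF`),
so the deviation allowed to the sample mean depends on `V` and not on `L`. Off an atypical event of
probability `O(K exp(-N Δ² / (1024 V²)))` the weight errors are at most `exp(B - β N Δ / 4)`. On
that event they are at most 1, and Cauchy–Schwarz with fourth moments pays the square root of its
probability (`setLIntegral_basinEvent_le`).

The constant must depend on the model alone although the distances `‖θ_k - θ₀‖` are conditioned
upon. Since `ρ_k` is quadratic in `θ`, its Lipschitz bound confines `θ_k` to a bounded set
(`norm_sub_le_of_lipschitzOnWith_rho`). So either the null prior has bounded support, with a bound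
that is a property of the prior, or regularity excludes irrelevant sources altogether
(`exists_ae_sq_norm_sub_le`). -/

namespace ColdStart

/-! ### Isotropic Gaussian laws: linear images, moments, tails. -/

section Gaussian

variable {d K N₀ N : ℕ}

open scoped InnerProductSpace in
lemma charFun_gaussLaw (σ : ℝ) (θ t : Vec d) :
    charFun (gaussLaw σ θ) t
      = Complex.exp (⟪t, θ⟫_ℝ * Complex.I - (σ ^ 2 * ‖t‖ ^ 2 : ℝ) / 2) := by
  have hS : ((σ ^ 2) • (1 : Matrix (Fin d) (Fin d) ℝ)).PosSemidef :=
    Matrix.PosSemidef.one.smul (sq_nonneg σ)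
  rw [gaussLaw, charFun_multivariateGaussian hS]
  congr 3
  rw [EuclideanSpace.real_norm_sq_eq, Matrix.smul_mulVec, Matrix.one_mulVec]
  simp [dotProduct, Finset.mul_sum, pow_two]
  refine Finset.sum_congr rfl fun i _ => by ring

instance isProbabilityMeasure_gaussLaw (σ : ℝ) (θ : Vec d) :
    IsProbabilityMeasure (gaussLaw σ θ) := by
  unfold gaussLaw; infer_instance

instance isProbabilityMeasure_dataLaw (σ : ℝ) (θ₀ : Vec d) (θ : Fin K → Vec d) :
    IsProbabilityMeasure (dataLaw N₀ N σ θ₀ θ) := by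
  unfold dataLaw; infer_instance

lemma gaussLaw_eq_map (σ : ℝ) (θ : Vec d) :
    gaussLaw σ θ = (stdGaussian (Vec d)).map (fun x => θ + σ • x) := by
  have hc : (fun x : Vec d => θ + σ • x) = (fun x => θ + x) ∘ (fun x => σ • x) := rfl
  have : IsProbabilityMeasure ((stdGaussian (Vec d)).map (fun x => θ + σ • x)) :=
    Measure.isProbabilityMeasure_map (by fun_prop)
  refine Measure.ext_of_charFun (funext fun t => ?_)
  rw [charFun_gaussLaw, hc, ← Measure.map_map (by fun_prop) (by fun_prop), charFun_map_const_add,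
    charFun_map_smul, charFun_stdGaussian, ← Complex.exp_add, norm_smul, real_inner_comm]
  congr 1
  push_cast
  rw [mul_pow, Real.norm_eq_abs, ← Complex.ofReal_pow |σ|, sq_abs]
  push_cast
  ring

lemma integral_cexp_inner_sub_gaussLaw (σ c : ℝ) (η t : Vec d) :
    ∫ x, Complex.exp (inner ℝ (c • (x - η)) t * Complex.I) ∂(gaussLaw σ η)
      = Complex.exp (-((σ ^ 2 * c ^ 2 * ‖t‖ ^ 2 : ℝ) / 2 : ℂ)) := by
  have h := charFun_gaussLaw σ η (c • t)
  rw [charFun_apply] at h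
  have h2 : ∀ x : Vec d, Complex.exp (inner ℝ (c • (x - η)) t * Complex.I)
      = Complex.exp (inner ℝ x (c • t) * Complex.I)
        * Complex.exp (-(inner ℝ (c • t) η * Complex.I)) := by
    intro x
    rw [← Complex.exp_add, real_inner_smul_left, inner_sub_left, real_inner_smul_right,
      real_inner_smul_left, real_inner_comm t η]
    congr 1
    push_cast
    ring
  simp_rw [h2]
  rw [integral_mul_const, h, ← Complex.exp_add, norm_smul]
  congr 1
  push_cast
  rw [mul_pow, Real.norm_eq_abs, ← Complex.ofReal_pow |c|, sq_abs]
  push_cast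
  ring

/-- A linear combination of the centred observations. -/
noncomputable def noise (θ₀ : Vec d) (θ : Fin K → Vec d) (a : ℝ) (b : Fin K → ℝ)
    (ω : Data d K N₀ N) : Vec d :=
  a • ∑ i, (ω.1 i - θ₀) + ∑ k, b k • ∑ i, (ω.2 k i - θ k)

lemma measurable_noise (θ₀ : Vec d) (θ : Fin K → Vec d) (a : ℝ) (b : Fin K → ℝ) :
    Measurable (noise (N₀ := N₀) (N := N) θ₀ θ a b) := by
  unfold noise; fun_prop

/-- A single characteristic-function computation that serves both the error of a source mean and the
oracle error. -/
lemma map_noise (σ : ℝ) (θ₀ : Vec d) (θ : Fin K → Vec d) (a : ℝ) (b : Fin K → ℝ) (s : ℝ)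
    (hs : s ^ 2 = σ ^ 2 * (N₀ * a ^ 2 + N * ∑ k, b k ^ 2)) :
    (dataLaw N₀ N σ θ₀ θ).map (noise θ₀ θ a b) = gaussLaw s 0 := by
  have : IsProbabilityMeasure ((dataLaw N₀ N σ θ₀ θ).map (noise θ₀ θ a b)) :=
    Measure.isProbabilityMeasure_map (measurable_noise ..).aemeasurable
  refine Measure.ext_of_charFun (funext fun t => ?_)
  rw [charFun_apply, integral_map (measurable_noise ..).aemeasurable
    (Measurable.aestronglyMeasurable (by fun_prop)), charFun_gaussLaw]
  have key : ∀ ω : Data d K N₀ N, Complex.exp (inner ℝ (noise θ₀ θ a b ω) t * Complex.I)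
      = (∏ i, Complex.exp (inner ℝ (a • (ω.1 i - θ₀)) t * Complex.I))
        * ∏ k, ∏ i, Complex.exp (inner ℝ (b k • (ω.2 k i - θ k)) t * Complex.I) := by
    intro ω
    simp only [← Complex.exp_sum, ← Complex.exp_add]
    congr 1
    simp only [noise, inner_add_left, sum_inner, real_inner_smul_left]
    push_cast
    simp only [Finset.mul_sum, Finset.sum_mul, add_mul]
  simp_rw [key]
  rw [dataLaw, integral_prod_mul
    (f := fun x : Fin N₀ → Vec d => ∏ i, Complex.exp (inner ℝ (a • (x i - θ₀)) t * Complex.I))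
    (g := fun y : Fin K → Fin N → Vec d =>
      ∏ k, ∏ i, Complex.exp (inner ℝ (b k • (y k i - θ k)) t * Complex.I)),
    integral_fintype_prod_eq_prod
      (f := fun _ x => Complex.exp (inner ℝ (a • (x - θ₀)) t * Complex.I)),
    integral_fintype_prod_eq_prod
      (f := fun k (y : Fin N → Vec d) =>
        ∏ i, Complex.exp (inner ℝ (b k • (y i - θ k)) t * Complex.I))]
  have h3 : ∀ k, ∫ y : Fin N → Vec d,
      ∏ i, Complex.exp (inner ℝ (b k • (y i - θ k)) t * Complex.I)
        ∂(Measure.pi fun _ => gaussLaw σ (θ k))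
        = Complex.exp (N * -((σ ^ 2 * b k ^ 2 * ‖t‖ ^ 2 : ℝ) / 2 : ℂ)) := by
    intro k
    rw [integral_fintype_prod_eq_prod
      (f := fun _ x => Complex.exp (inner ℝ (b k • (x - θ k)) t * Complex.I))]
    simp_rw [integral_cexp_inner_sub_gaussLaw]
    rw [Finset.prod_const, Finset.card_univ, Fintype.card_fin, ← Complex.exp_nat_mul]
  simp_rw [h3, integral_cexp_inner_sub_gaussLaw]
  rw [Finset.prod_const, Finset.card_univ, Fintype.card_fin, ← Complex.exp_nat_mul,
    ← Complex.exp_sum, ← Complex.exp_add, hs]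
  congr 1
  push_cast
  simp only [inner_zero_right, Complex.ofReal_zero, zero_mul, zero_sub, Finset.mul_sum,
    Finset.sum_mul, Finset.sum_div, mul_add, add_mul, add_div, neg_add, ← Finset.sum_neg_distrib]
  congr 1
  · ring
  · refine Finset.sum_congr rfl fun k _ => by ring

lemma lintegral_norm_sq_stdGaussian :
    ∫⁻ x, ENNReal.ofReal (‖x‖ ^ 2) ∂(stdGaussian (Vec d)) = ENNReal.ofReal d := by
  have h1 : ∀ i : Fin d, MeasurePreserving (fun x : Vec d => x i) (stdGaussian (Vec d))
      (gaussianReal 0 1) := by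
    intro i
    have := measurePreserving_eval_multivariateGaussian (ι := Fin d) (μ := 0) (S := 1)
      Matrix.PosSemidef.one (i := i)
    simpa using this
  have h2 : ∫⁻ x : ℝ, ENNReal.ofReal (x ^ 2) ∂(gaussianReal 0 1) = 1 := by
    rw [← ofReal_integral_eq_lintegral_ofReal]
    · have := variance_eq_integral (X := id) (μ := gaussianReal 0 1) (by fun_prop)
      rw [variance_id_gaussianReal] at this
      simp at this
      rw [← this]; simp
    · exact (memLp_id_gaussianReal (μ := 0) (v := 1) 2).integrable_sq
    · exact ae_of_all _ fun x => sq_nonneg x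
  have h3 : ∀ x : Vec d, ENNReal.ofReal (‖x‖ ^ 2) = ∑ i, ENNReal.ofReal (x i ^ 2) := by
    intro x
    rw [EuclideanSpace.real_norm_sq_eq, ENNReal.ofReal_sum_of_nonneg fun i _ => sq_nonneg _]
  simp_rw [h3]
  rw [lintegral_finsetSum _ (fun i _ => by fun_prop)]
  have h4 : ∀ i : Fin d, ∫⁻ x : Vec d, ENNReal.ofReal (x i ^ 2) ∂(stdGaussian (Vec d)) = 1 := by
    intro i
    rw [(h1 i).lintegral_comp (f := fun y : ℝ => ENNReal.ofReal (y ^ 2)) (by fun_prop), h2]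
  simp [h4]

lemma exists_lintegral_norm_pow_four_stdGaussian_le (d : ℕ) :
    ∃ M : ℝ, 0 ≤ M ∧
      ∫⁻ x, ENNReal.ofReal (‖x‖ ^ 4) ∂(stdGaussian (Vec d)) ≤ ENNReal.ofReal M := by
  have hi : Integrable (fun x : Vec d => ‖x‖ ^ 4) (stdGaussian (Vec d)) := by
    have := (IsGaussian.memLp_id (stdGaussian (Vec d)) 4 (by norm_num)).integrable_norm_pow
      (p := 4) (by norm_num)
    simpa using this
  refine ⟨∫ x, ‖x‖ ^ 4 ∂(stdGaussian (Vec d)), integral_nonneg fun x => by positivity, ?_⟩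
  rw [ofReal_integral_eq_lintegral_ofReal hi (ae_of_all _ fun x => by positivity)]

/-- Markov's inequality for `exp (‖x‖² / 4)`, whose expectation factorizes over the coordinates. The
exponent 1/4 lies below the critical 1/2, so each factor is finite. -/
lemma exists_stdGaussian_norm_tail_le (d : ℕ) :
    ∃ H : ℝ, 0 ≤ H ∧ ∀ t : ℝ, 0 ≤ t →
      stdGaussian (Vec d) {x | t ≤ ‖x‖} ≤ ENNReal.ofReal (H * Real.exp (-(t ^ 2 / 4))) := by
  have h1 : Integrable (fun x : ℝ => Real.exp (x ^ 2 / 4)) (gaussianReal 0 1) := by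
    rw [gaussianReal_of_var_ne_zero _ one_ne_zero, integrable_withDensity_iff_integrable_smul'
      (measurable_gaussianPDF 0 1) (ae_of_all _ fun x => gaussianPDF_lt_top)]
    have h2 : Integrable fun x : ℝ => (√(2 * Real.pi))⁻¹ * Real.exp (-(1 / 4) * x ^ 2) :=
      (integrable_exp_neg_mul_sq (by norm_num)).const_mul _
    refine h2.congr (ae_of_all _ fun x => ?_)
    simp only [toReal_gaussianPDF, gaussianPDFReal, smul_eq_mul]
    rw [mul_assoc, ← Real.exp_add]
    simp only [NNReal.coe_one, mul_one, sub_zero]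
    congr 2
    ring
  set J := ∫ x, Real.exp (x ^ 2 / 4) ∂(gaussianReal 0 1)
  have hJ : 0 ≤ J := integral_nonneg fun x => (Real.exp_pos _).le
  have h2 : ∫⁻ x, ENNReal.ofReal (Real.exp (‖x‖ ^ 2 / 4)) ∂(stdGaussian (Vec d))
      = ENNReal.ofReal (J ^ d) := by
    rw [← map_pi_eq_stdGaussian, lintegral_map (by fun_prop) (by fun_prop)]
    have h3 : ∀ x : Fin d → ℝ, Real.exp (‖WithLp.toLp 2 x‖ ^ 2 / 4)
        = ∏ i, Real.exp (x i ^ 2 / 4) := by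
      intro x
      rw [EuclideanSpace.real_norm_sq_eq, Finset.sum_div, Real.exp_sum]
    simp_rw [h3]
    rw [← ofReal_integral_eq_lintegral_ofReal, integral_fintype_prod_eq_prod
      (f := fun _ x => Real.exp (x ^ 2 / 4))]
    · simp [J]
    · exact Integrable.fintype_prod (f := fun _ x => Real.exp (x ^ 2 / 4)) fun _ => h1
    · exact ae_of_all _ fun x => Finset.prod_nonneg fun i _ => (Real.exp_pos _).le
  refine ⟨J ^ d, by positivity, fun t ht => ?_⟩
  have h4 := mul_meas_ge_le_lintegral (μ := stdGaussian (Vec d))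
    (f := fun x => ENNReal.ofReal (Real.exp (‖x‖ ^ 2 / 4))) (by fun_prop)
    (ENNReal.ofReal (Real.exp (t ^ 2 / 4)))
  rw [h2] at h4
  have h5 : {x : Vec d | t ≤ ‖x‖} ⊆
      {x | ENNReal.ofReal (Real.exp (t ^ 2 / 4)) ≤ ENNReal.ofReal (Real.exp (‖x‖ ^ 2 / 4))} := by
    intro x hx
    refine ENNReal.ofReal_le_ofReal (Real.exp_le_exp.2 ?_)
    have : t ≤ ‖x‖ := hx
    gcongr
  have h6 : ENNReal.ofReal (Real.exp (t ^ 2 / 4)) * stdGaussian (Vec d) {x | t ≤ ‖x‖}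
      ≤ ENNReal.ofReal (J ^ d) := le_trans (by gcongr) h4
  rw [Real.exp_neg, ← div_eq_mul_inv, ENNReal.ofReal_div_of_pos (Real.exp_pos _),
    ENNReal.le_div_iff_mul_le (Or.inl (by simp [Real.exp_pos])) (Or.inl (by simp)), mul_comm]
  exact h6

lemma lintegral_norm_sq_gaussLaw (s : ℝ) :
    ∫⁻ x : Vec d, ENNReal.ofReal (‖x‖ ^ 2) ∂(gaussLaw s 0) = ENNReal.ofReal (d * s ^ 2) := by
  rw [gaussLaw_eq_map, lintegral_map (by fun_prop) (by fun_prop)]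
  simp only [zero_add, norm_smul, mul_pow, Real.norm_eq_abs, sq_abs]
  simp_rw [ENNReal.ofReal_mul (sq_nonneg s)]
  rw [lintegral_const_mul _ (by fun_prop), lintegral_norm_sq_stdGaussian,
    ← ENNReal.ofReal_mul (sq_nonneg s), mul_comm]

lemma lintegral_norm_pow_four_gaussLaw_le {M : ℝ}
    (hM : ∫⁻ x, ENNReal.ofReal (‖x‖ ^ 4) ∂(stdGaussian (Vec d)) ≤ ENNReal.ofReal M) (s : ℝ) :
    ∫⁻ x : Vec d, ENNReal.ofReal (‖x‖ ^ 4) ∂(gaussLaw s 0) ≤ ENNReal.ofReal (M * s ^ 4) := by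
  have hs : 0 ≤ s ^ 4 := by positivity
  have hs' : |s| ^ 4 = s ^ 4 := by rw [pow_abs, abs_of_nonneg hs]
  rw [gaussLaw_eq_map, lintegral_map (by fun_prop) (by fun_prop)]
  simp only [zero_add, norm_smul, mul_pow, Real.norm_eq_abs, hs']
  simp_rw [ENNReal.ofReal_mul hs]
  rw [lintegral_const_mul _ (by fun_prop), mul_comm M, ENNReal.ofReal_mul hs]
  gcongr

lemma gaussLaw_norm_tail_le {H : ℝ}
    (hH : ∀ t : ℝ, 0 ≤ t →
      stdGaussian (Vec d) {x | t ≤ ‖x‖} ≤ ENNReal.ofReal (H * Real.exp (-(t ^ 2 / 4))))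
    {s t : ℝ} (hs : 0 < s) (ht : 0 ≤ t) :
    gaussLaw s (0 : Vec d) {x | t ≤ ‖x‖}
      ≤ ENNReal.ofReal (H * Real.exp (-(t ^ 2 / (4 * s ^ 2)))) := by
  rw [gaussLaw_eq_map, Measure.map_apply (by fun_prop)
    (measurableSet_le measurable_const measurable_norm)]
  have h1 := hH (t / s) (by positivity)
  have h2 : (fun x : Vec d => 0 + s • x) ⁻¹' {x | t ≤ ‖x‖} = {x | t / s ≤ ‖x‖} := by
    ext x
    simp [norm_smul, abs_of_pos hs, div_le_iff₀ hs, mul_comm]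
  rw [h2]
  convert h1 using 5
  field_simp

end Gaussian

/-! ### Affine structure of the log-likelihood ratio and its consequences for regularity. -/

section LogLikelihoodRatio

variable {d K N₀ N : ℕ} {σ : ℝ} {φ : Measure (Vec d)}

lemma gaussDensity_pos (hσ : 0 < σ) (θ x : Vec d) : 0 < gaussDensity σ θ x := by
  unfold gaussDensity
  have := Real.pi_pos
  positivity

lemma measurable_gaussDensity :
    Measurable fun z : Vec d × Vec d => gaussDensity σ z.2 z.1 := by
  unfold gaussDensity; fun_prop

lemma nullDensity_pos (hσ : 0 < σ) [IsProbabilityMeasure φ] (x : Vec d) :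
    0 < nullDensity σ φ x := by
  have hm : Measurable fun ϑ : Vec d => gaussDensity σ ϑ x := by unfold gaussDensity; fun_prop
  have hi : Integrable (fun ϑ => gaussDensity σ ϑ x) φ := by
    refine Integrable.of_bound hm.aestronglyMeasurable ((√(2 * Real.pi * σ ^ 2))⁻¹ ^ d)
      (ae_of_all _ fun ϑ => ?_)
    rw [Real.norm_eq_abs, abs_of_pos (gaussDensity_pos hσ _ _)]
    refine mul_le_of_le_one_right (by positivity) (Real.exp_le_one_iff.2 ?_)
    have : 0 ≤ ‖x - ϑ‖ ^ 2 / (2 * σ ^ 2) := by positivity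
    linarith
  rw [nullDensity, integral_pos_iff_support_of_nonneg
    (fun ϑ => (gaussDensity_pos hσ ϑ x).le) hi]
  have : Function.support (fun ϑ => gaussDensity σ ϑ x) = Set.univ :=
    Set.eq_univ_of_forall fun ϑ => (gaussDensity_pos hσ ϑ x).ne'
  rw [this]
  simp

lemma measurable_logLR [SFinite φ] (θ : Vec d) : Measurable (logLR σ φ θ) := by
  have h0 : StronglyMeasurable (fun z : Vec d × Vec d => gaussDensity σ z.2 z.1) :=
    measurable_gaussDensity.stronglyMeasurable
  have h1 : Measurable (nullDensity σ φ) := h0.integral_prod_right'.measurable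
  have h2 : Measurable fun x : Vec d => gaussDensity σ θ x := by unfold gaussDensity; fun_prop
  exact (h2.div h1).log

/-- The log-likelihood ratios at two parameters differ by an affine function of the sample. -/
lemma logLR_sub (hσ : 0 < σ) [IsProbabilityMeasure φ] (ϑ θ θ' x : Vec d) :
    logLR σ φ θ x - logLR σ φ θ' x
      = inner ℝ (x - ϑ) (θ - θ') / σ ^ 2
        + (2 * inner ℝ (ϑ - θ') (θ - θ') - ‖θ - θ'‖ ^ 2) / (2 * σ ^ 2) := by
  have hp : ∀ η, logLR σ φ η x
      = Real.log ((√(2 * Real.pi * σ ^ 2))⁻¹ ^ d) - ‖x - η‖ ^ 2 / (2 * σ ^ 2)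
        - Real.log (nullDensity σ φ x) := by
    intro η
    have := Real.pi_pos
    rw [logLR, Real.log_div (gaussDensity_pos hσ _ _).ne' (nullDensity_pos hσ x).ne',
      gaussDensity, Real.log_mul (by positivity) (Real.exp_pos _).ne', Real.log_exp]
    ring
  have h1 : ‖x - θ‖ ^ 2
      = ‖x - θ'‖ ^ 2 - 2 * inner ℝ (x - θ') (θ - θ') + ‖θ - θ'‖ ^ 2 := by
    rw [← norm_sub_sq_real, sub_sub_sub_cancel_right]
  have h2 : inner ℝ (x - θ') (θ - θ')
      = inner ℝ (x - ϑ) (θ - θ') + inner ℝ (ϑ - θ') (θ - θ') := by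
    rw [← inner_add_left, sub_add_sub_cancel]
  rw [hp, hp, h1, h2]
  field_simp
  ring

lemma integral_inner_sub_gaussLaw (ϑ u : Vec d) :
    ∫ x, inner ℝ (x - ϑ) u ∂(gaussLaw σ ϑ) = 0 := by
  have hi : Integrable (fun x : Vec d => x) (gaussLaw σ ϑ) := by
    unfold gaussLaw; exact IsGaussian.integrable_fun_id
  have h : ∫ x, x ∂(gaussLaw σ ϑ) = ϑ := by
    unfold gaussLaw; exact integral_id_multivariateGaussian
  simp_rw [real_inner_comm u]
  rw [integral_inner (f := fun x => x - ϑ) (hi.sub (integrable_const _)), integral_sub hi (integrable_const _), h]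
  simp

lemma rho_sub (hσ : 0 < σ) [IsProbabilityMeasure φ] {ϑ θ θ' : Vec d}
    (h : Integrable (logLR σ φ θ) (gaussLaw σ ϑ)) (h' : Integrable (logLR σ φ θ') (gaussLaw σ ϑ)) :
    rho σ φ ϑ θ - rho σ φ ϑ θ'
      = (2 * inner ℝ (ϑ - θ') (θ - θ') - ‖θ - θ'‖ ^ 2) / (2 * σ ^ 2) := by
  have hi : Integrable (fun x : Vec d => x) (gaussLaw σ ϑ) := by
    unfold gaussLaw; exact IsGaussian.integrable_fun_id
  rw [rho, rho, ← integral_sub h h']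
  simp_rw [logLR_sub hσ ϑ]
  have h1 : Integrable (fun x => inner ℝ (x - ϑ) (θ - θ')) (gaussLaw σ ϑ) :=
    (hi.sub (integrable_const ϑ)).inner_const _
  rw [integral_add (h1.div_const _) (integrable_const _), integral_div,
    integral_inner_sub_gaussLaw]
  simp

/-- Centring removes the deterministic part of `logLR_sub`: moving the parameter changes the
fluctuation only by a linear functional of the sample. -/
lemma logLR_sub_rho (hσ : 0 < σ) [IsProbabilityMeasure φ] {ϑ θ θ' : Vec d}
    (h : Integrable (logLR σ φ θ) (gaussLaw σ ϑ)) (h' : Integrable (logLR σ φ θ') (gaussLaw σ ϑ))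
    (x : Vec d) :
    logLR σ φ θ x - rho σ φ ϑ θ
      = (logLR σ φ θ' x - rho σ φ ϑ θ') + inner ℝ (x - ϑ) (θ - θ') / σ ^ 2 := by
  have h1 := rho_sub hσ h h'
  have h2 := logLR_sub (φ := φ) hσ ϑ θ θ' x
  linarith

lemma integrable_logLR_of_hasSubgaussianMGF {c : ℝ≥0} {m : ℝ} {ϑ θ : Vec d}
    (h : HasSubgaussianMGF (fun x => logLR σ φ θ x - m) c (gaussLaw σ ϑ)) :
    Integrable (logLR σ φ θ) (gaussLaw σ ϑ) := by
  have h1 := h.integrable.add (integrable_const m)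
  refine h1.congr (ae_of_all _ fun x => ?_)
  simp

lemma mgf_inner_gaussLaw (ϑ u : Vec d) (t : ℝ) :
    mgf (fun x => inner ℝ (x - ϑ) u) (gaussLaw σ ϑ) t
      = Real.exp (σ ^ 2 * ‖u‖ ^ 2 * t ^ 2 / 2) := by
  have hm : Measurable fun x : Vec d => inner ℝ (x - ϑ) u := by fun_prop
  have hmap : (gaussLaw σ ϑ).map (fun x => inner ℝ (x - ϑ) u)
      = gaussianReal 0 (Real.toNNReal (σ ^ 2 * ‖u‖ ^ 2)) := by
    have : IsProbabilityMeasure ((gaussLaw σ ϑ).map (fun x => inner ℝ (x - ϑ) u)) :=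
      Measure.isProbabilityMeasure_map hm.aemeasurable
    refine Measure.ext_of_charFun (funext fun t => ?_)
    rw [charFun_gaussianReal, charFun_apply_real, integral_map hm.aemeasurable
      (Measurable.aestronglyMeasurable (by fun_prop))]
    have := integral_cexp_inner_sub_gaussLaw σ t ϑ u
    simp_rw [real_inner_smul_left, Complex.ofReal_mul] at this
    rw [this, Real.coe_toNNReal _ (by positivity)]
    congr 1
    push_cast
    ring
  rw [mgf_gaussianReal hmap, Real.coe_toNNReal _ (by positivity)]
  simp

/-- A sub-Gaussian log-likelihood ratio at two parameters bounds their distance. -/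
lemma norm_sub_le_of_hasSubgaussianMGF (hσ : 0 < σ) [IsProbabilityMeasure φ] {V : ℝ≥0}
    {ϑ θ θ' : Vec d}
    (h : HasSubgaussianMGF (fun x => logLR σ φ θ x - rho σ φ ϑ θ) (V ^ 2) (gaussLaw σ ϑ))
    (h' : HasSubgaussianMGF (fun x => logLR σ φ θ' x - rho σ φ ϑ θ') (V ^ 2) (gaussLaw σ ϑ)) :
    ‖θ - θ'‖ ≤ 2 * V * σ := by
  have hi := integrable_logLR_of_hasSubgaussianMGF h
  have hi' := integrable_logLR_of_hasSubgaussianMGF h'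
  -- The two variables are dependent, so the parameters add as `(V + V)² = 4V²`. Their difference is
  -- exactly Gaussian with variance `‖θ - θ'‖² / σ²`, and comparing the two exponents gives the
  -- bound.
  have h1 := (h.add h'.neg).mgf_le 1
  have h2 : mgf (fun x => (logLR σ φ θ x - rho σ φ ϑ θ)
      + (-fun x => logLR σ φ θ' x - rho σ φ ϑ θ') x) (gaussLaw σ ϑ) 1
      = mgf (fun x => inner ℝ (x - ϑ) (θ - θ')) (gaussLaw σ ϑ) (σ ^ 2)⁻¹ := by
    unfold mgf
    refine integral_congr_ae (ae_of_all _ fun x => ?_)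
    simp only [Pi.neg_apply, logLR_sub_rho hσ hi hi' x]
    ring_nf
  rw [h2, mgf_inner_gaussLaw, Real.exp_le_exp, NNReal.sqrt_sq] at h1
  push_cast at h1
  have h3 : σ ^ 2 * ‖θ - θ'‖ ^ 2 * (σ ^ 2)⁻¹ ^ 2 = ‖θ - θ'‖ ^ 2 / σ ^ 2 := by field_simp
  rw [h3, div_le_div_iff_of_pos_right two_pos, div_le_iff₀ (by positivity)] at h1
  exact (sq_le_sq₀ (norm_nonneg _) (by positivity)).1 (h1.trans (le_of_eq (by ring)))

/-- The slope of the quadratic `rho σ φ ϑ` near `θ₀` is of order `‖ϑ - θ₀‖ / σ²`. A step `v` of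
length `δ` towards `ϑ` detects it: `(2 δ m - δ²) / (2σ²) ≤ L δ`. -/
lemma norm_sub_le_of_lipschitzOnWith_rho (hσ : 0 < σ) [IsProbabilityMeasure φ] {L : ℝ≥0}
    {ϑ θ₀ : Vec d} {U : Set (Vec d)} {δ : ℝ} (hδ : 0 < δ) (hU : Metric.closedBall θ₀ δ ⊆ U)
    (hi : ∀ θ ∈ U, Integrable (logLR σ φ θ) (gaussLaw σ ϑ))
    (hL : LipschitzOnWith L (fun θ => rho σ φ ϑ θ) U) :
    ‖ϑ - θ₀‖ ≤ L * σ ^ 2 + δ := by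
  rcases eq_or_ne ϑ θ₀ with rfl | hne
  · simp only [sub_self, norm_zero]; positivity
  have hm : 0 < ‖ϑ - θ₀‖ := norm_pos_iff.2 (sub_ne_zero.2 hne)
  set m := ‖ϑ - θ₀‖ with hm_def
  set v : Vec d := (δ / m) • (ϑ - θ₀) with hv
  have hvn : ‖v‖ = δ := by
    rw [hv, norm_smul, Real.norm_eq_abs, abs_of_pos (by positivity), ← hm_def]
    field_simp
  have hin : inner ℝ (ϑ - θ₀) v = δ * m := by
    rw [hv, real_inner_smul_right, real_inner_self_eq_norm_sq, ← hm_def]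
    field_simp
  have h0 : θ₀ ∈ U := hU (Metric.mem_closedBall_self hδ.le)
  have h1 : θ₀ + v ∈ U := hU (by simp [hvn])
  have h2 := rho_sub hσ (hi _ h1) (hi _ h0)
  rw [add_sub_cancel_left, hin, hvn] at h2
  have h3 := hL.dist_le_mul _ h1 _ h0
  rw [Real.dist_eq, dist_eq_norm, add_sub_cancel_left, hvn, h2] at h3
  have h4 := (le_abs_self _).trans h3
  rw [div_le_iff₀ (by positivity)] at h4
  nlinarith

end LogLikelihoodRatio

/-! ### Concentration of sums over one source sample. -/

section Tails

variable {d K N₀ N : ℕ} {σ : ℝ}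

lemma measurePreserving_source (θ₀ : Vec d) (θ : Fin K → Vec d) (k : Fin K) :
    MeasurePreserving (fun ω : Data d K N₀ N => ω.2 k) (dataLaw N₀ N σ θ₀ θ)
      (Measure.pi fun _ : Fin N => gaussLaw σ (θ k)) :=
  (measurePreserving_eval (fun k : Fin K => Measure.pi fun _ : Fin N => gaussLaw σ (θ k)) k).comp
    measurePreserving_snd

lemma dataLaw_abs_sum_ge_le {θ₀ : Vec d} {θ : Fin K → Vec d} {k : Fin K} {V : ℝ≥0} {f : Vec d → ℝ}
    (hfm : Measurable f) (hf : HasSubgaussianMGF f (V ^ 2) (gaussLaw σ (θ k))) {t : ℝ}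
    (ht : 0 ≤ t) :
    dataLaw N₀ N σ θ₀ θ {ω | t ≤ |∑ i, f (ω.2 k i)|}
      ≤ ENNReal.ofReal (2 * Real.exp (-(t ^ 2 / (2 * N * V ^ 2)))) := by
  have hind : iIndepFun (fun (i : Fin N) (x : Fin N → Vec d) => f (x i))
      (Measure.pi fun _ : Fin N => gaussLaw σ (θ k)) :=
    iIndepFun_pi (X := fun _ => f) fun _ => hfm.aemeasurable
  have hsub : HasSubgaussianMGF (fun x : Fin N → Vec d => ∑ i, f (x i)) (∑ _i : Fin N, V ^ 2)
      (Measure.pi fun _ : Fin N => gaussLaw σ (θ k)) := by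
    refine HasSubgaussianMGF.sum_of_iIndepFun hind fun i _ => ?_
    have hp := measurePreserving_eval (fun _ : Fin N => gaussLaw σ (θ k)) i
    exact HasSubgaussianMGF.of_map (Y := Function.eval i) hp.aemeasurable (by rwa [hp.map_eq])
  have hmp := measurePreserving_source (N₀ := N₀) (N := N) (σ := σ) θ₀ θ k
  have hd : HasSubgaussianMGF (fun ω : Data d K N₀ N => ∑ i, f (ω.2 k i)) (∑ _i : Fin N, V ^ 2)
      (dataLaw N₀ N σ θ₀ θ) :=
    HasSubgaussianMGF.of_map (X := fun x : Fin N → Vec d => ∑ i, f (x i))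
      (Y := fun ω : Data d K N₀ N => ω.2 k) hmp.aemeasurable
      (by rwa [hmp.map_eq])
  have hc : ((∑ _i : Fin N, V ^ 2 : ℝ≥0) : ℝ) = N * V ^ 2 := by simp
  have h1 := hd.measure_ge_le ht
  have h2 := hd.neg.measure_ge_le ht
  rw [hc] at h1 h2
  have h3 : {ω : Data d K N₀ N | t ≤ |∑ i, f (ω.2 k i)|}
      ⊆ {ω | t ≤ ∑ i, f (ω.2 k i)}
        ∪ {ω | t ≤ (-fun ω : Data d K N₀ N => ∑ i, f (ω.2 k i)) ω} := by
    intro ω hω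
    exact le_abs.1 (show t ≤ |∑ i, f (ω.2 k i)| from hω)
  have he : -t ^ 2 / (2 * (N * (V : ℝ) ^ 2)) = -(t ^ 2 / (2 * N * V ^ 2)) := by
    rw [neg_div, mul_assoc]
  rw [he] at h1 h2
  refine (measure_mono h3).trans ((measure_union_le _ _).trans ?_)
  rw [two_mul, ENNReal.ofReal_add (Real.exp_pos _).le (Real.exp_pos _).le]
  exact add_le_add ((ENNReal.le_ofReal_iff_toReal_le (measure_ne_top _ _) (Real.exp_pos _).le).2 h1)
    ((ENNReal.le_ofReal_iff_toReal_le (measure_ne_top _ _) (Real.exp_pos _).le).2 h2)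

end Tails

/-! ### Weighted means as perturbations of the oracle mean. -/

section WeightedMean

variable {E : Type*} [NormedAddCommGroup E] [NormedSpace ℝ E] {ι : Type*} [Fintype ι]
  [DecidableEq ι]

/-- The precision-weighted mean of `e₀` and `(e k)_{k ∈ R}`. -/
noncomputable def oracleMean (n₀ n : ℝ) (R : Finset ι) (e₀ : E) (e : ι → E) : E :=
  (n₀ + n * R.card)⁻¹ • (n₀ • e₀ + n • ∑ k ∈ R, e k)

/-- Deviations from the oracle mean cancel under the oracle weights, so only the weight errors
contribute. -/
lemma weightedMean_eq_oracleMean_add {n₀ n : ℝ} (hn₀ : 0 < n₀) (hn : 0 ≤ n) (R : Finset ι)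
    (e₀ : E) (e : ι → E) {w : ι → ℝ} (hw : ∀ k, 0 ≤ w k) :
    (n₀ + n * ∑ k, w k)⁻¹ • (n₀ • e₀ + n • ∑ k, w k • e k)
      = oracleMean n₀ n R e₀ e + (n₀ + n * ∑ k, w k)⁻¹ •
        (n • ∑ k, (w k - if k ∈ R then 1 else 0) • (e k - oracleMean n₀ n R e₀ e)) := by
  have hW : 0 < n₀ + n * ∑ k, w k :=
    add_pos_of_pos_of_nonneg hn₀ (mul_nonneg hn (Finset.sum_nonneg fun k _ => hw k))
  have hW' : 0 < n₀ + n * (R.card : ℝ) := by positivity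
  have ho : (n₀ + n * (R.card : ℝ)) • oracleMean n₀ n R e₀ e = n₀ • e₀ + n • ∑ k ∈ R, e k := by
    rw [oracleMean, smul_inv_smul₀ hW'.ne']
  set o := oracleMean n₀ n R e₀ e
  have h1 : ∑ k, (w k - if k ∈ R then 1 else 0) • (e k - o)
      = ∑ k, w k • e k - ∑ k ∈ R, e k - (∑ k, w k - R.card) • o := by
    simp only [smul_sub, sub_smul, Finset.sum_sub_distrib, ite_smul, one_smul, zero_smul,
      Finset.sum_ite_mem, Finset.univ_inter, ← Finset.sum_smul, Finset.sum_const,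
      ← Nat.cast_smul_eq_nsmul ℝ]
  have h2 : n₀ • e₀ + n • ∑ k, w k • e k
      = (n₀ + n * ∑ k, w k) • o
        + n • ∑ k, (w k - if k ∈ R then 1 else 0) • (e k - o) := by
    have h3 : n₀ • e₀ = (n₀ + n * (R.card : ℝ)) • o - n • ∑ k ∈ R, e k := by rw [ho]; abel
    rw [h1, h3]
    module
  rw [h2, smul_add, inv_smul_smul₀ hW.ne']

lemma norm_weightedMean_le {n₀ n : ℝ} (hn₀ : 0 < n₀) (hn : 0 ≤ n) (R : Finset ι)
    (e₀ : E) (e : ι → E) {w : ι → ℝ} (hw : ∀ k, 0 ≤ w k) {ε : ℝ}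
    (hε : ∀ k, |w k - if k ∈ R then 1 else 0| ≤ ε) :
    ‖(n₀ + n * ∑ k, w k)⁻¹ • (n₀ • e₀ + n • ∑ k, w k • e k)‖
      ≤ ‖oracleMean n₀ n R e₀ e‖ + n / n₀ * (ε * ∑ k, ‖e k - oracleMean n₀ n R e₀ e‖) := by
  have hs : 0 ≤ n * ∑ k, w k := mul_nonneg hn (Finset.sum_nonneg fun k _ => hw k)
  rw [weightedMean_eq_oracleMean_add hn₀ hn R e₀ e hw]
  refine (norm_add_le _ _).trans ?_
  have h1 : ‖∑ k, (w k - if k ∈ R then 1 else 0) • (e k - oracleMean n₀ n R e₀ e)‖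
      ≤ ε * ∑ k, ‖e k - oracleMean n₀ n R e₀ e‖ := by
    rw [Finset.mul_sum]
    refine norm_sum_le_of_le _ fun k _ => ?_
    rw [norm_smul, Real.norm_eq_abs]
    exact mul_le_mul_of_nonneg_right (hε k) (norm_nonneg _)
  have h2 := (norm_nonneg _).trans h1
  -- The total weight is at least `n₀` because the weights are nonnegative; this is the source of
  -- the factor `n / n₀`.
  rw [norm_smul, norm_smul, Real.norm_of_nonneg hn, Real.norm_of_nonneg (by positivity),
    ← mul_assoc, div_eq_inv_mul]
  gcongr
  linarith

end WeightedMean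

/-! ### Weight errors in the basin and the limit of the iterates. -/

section EM

variable {d K N₀ N : ℕ} {σ : ℝ} {φ : Measure (Vec d)}

lemma emStep_sub (β : ℝ) (p : Fin K → ℝ) (ω : Data d K N₀ N) (hN₀ : 0 < N₀) (θ₀ θ : Vec d) :
    emStep σ φ β p ω θ - θ₀
      = ((N₀ : ℝ) + N * ∑ k, emWeight σ φ β (p k) (ω.2 k) θ)⁻¹ •
        ((N₀ : ℝ) • (sampleMean ω.1 - θ₀) + (N : ℝ) •
          ∑ k, emWeight σ φ β (p k) (ω.2 k) θ • (sampleMean (ω.2 k) - θ₀)) := by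
  have hW : 0 < (N₀ : ℝ) + N * ∑ k, emWeight σ φ β (p k) (ω.2 k) θ :=
    add_pos_of_pos_of_nonneg (by exact_mod_cast hN₀)
      (mul_nonneg (by positivity) (Finset.sum_nonneg fun k _ => Real.sigmoid_nonneg _))
  have h : (N₀ : ℝ) • (sampleMean ω.1 - θ₀) + (N : ℝ) •
      ∑ k, emWeight σ φ β (p k) (ω.2 k) θ • (sampleMean (ω.2 k) - θ₀)
      = ((N₀ : ℝ) • sampleMean ω.1 + (N : ℝ) •
          ∑ k, emWeight σ φ β (p k) (ω.2 k) θ • sampleMean (ω.2 k))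
        - ((N₀ : ℝ) + N * ∑ k, emWeight σ φ β (p k) (ω.2 k) θ) • θ₀ := by
    simp only [smul_sub, Finset.sum_sub_distrib, ← Finset.sum_smul]
    module
  rw [h, smul_sub, inv_smul_smul₀ hW.ne', emStep]

lemma sigmoid_le_exp (z : ℝ) : Real.sigmoid z ≤ Real.exp z := by
  rw [Real.sigmoid_def, inv_le_comm₀ (by positivity) (Real.exp_pos _), ← Real.exp_neg]
  linarith

/-- The event that the source sample is atypical: either the log-likelihood ratio at `θ₀` or the
sample mean is far from its expectation. -/
def atypical (σ : ℝ) (φ : Measure (Vec d)) (Δ V : ℝ) (θ₀ : Vec d) (θ : Fin K → Vec d)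
    (k : Fin K) : Set (Data d K N₀ N) :=
  {ω | N * Δ / 8 ≤ |∑ i, (logLR σ φ θ₀ (ω.2 k i) - rho σ φ (θ k) θ₀)|}
    ∪ {ω | σ * Δ / (16 * V) ≤ ‖sampleMean (ω.2 k) - θ k‖}

lemma abs_log_le_logitBound (p : Fin K → ℝ) (k : Fin K) :
    |Real.log (p k / (1 - p k))| ≤ logitBound p :=
  le_ciSup (f := fun k => |Real.log (p k / (1 - p k))|) (Set.finite_range _).bddAbove k

lemma sum_sub_eq_smul_sampleMean_sub {n : ℕ} (hn : 0 < n) (x : Fin n → Vec d) (η : Vec d) :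
    ∑ i, (x i - η) = (n : ℝ) • (sampleMean x - η) := by
  have : (n : ℝ) ≠ 0 := by exact_mod_cast hn.ne'
  rw [sampleMean, smul_sub, smul_inv_smul₀ this, Finset.sum_sub_distrib]
  simp [← Nat.cast_smul_eq_nsmul ℝ]

/-- Outside the atypical event, the log-likelihood ratio of a source sample is uniformly close to
its expectation at the truth over the basin. -/
lemma abs_sum_logLR_sub_le (hσ : 0 < σ) [IsProbabilityMeasure φ] {θ₀ : Vec d}
    {θ : Fin K → Vec d} {V L : ℝ≥0} {U : Set (Vec d)} {Δ : ℝ} (hV : 0 < V) (hL : 0 < L)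
    (hN : 0 < N) (hU : U ∈ 𝓝 θ₀) (hreg : RegularOn σ φ V L U θ) {k : Fin K} {ω : Data d K N₀ N}
    (hω : ω ∉ atypical σ φ Δ V θ₀ θ k) {ϑ : Vec d} (hϑ : ϑ ∈ U)
    (hϑ' : ‖ϑ - θ₀‖ ≤ 1 / 2 * Δ / L) :
    |∑ i, logLR σ φ ϑ (ω.2 k i) - N * rho σ φ (θ k) θ₀| ≤ 3 / 4 * (N * Δ) := by
  have h0 := mem_of_mem_nhds hU
  have hs := (hreg k).1 ϑ hϑ
  have hs0 := (hreg k).1 θ₀ h0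
  have hi := integrable_logLR_of_hasSubgaussianMGF hs
  have hi0 := integrable_logLR_of_hasSubgaussianMGF hs0
  have hV' : (0 : ℝ) < V := hV
  have hL' : (0 : ℝ) < L := hL
  have hN' : (0 : ℝ) < N := by exact_mod_cast hN
  obtain ⟨hω1, hω2⟩ : |∑ i, (logLR σ φ θ₀ (ω.2 k i) - rho σ φ (θ k) θ₀)| < N * Δ / 8 ∧
      ‖sampleMean (ω.2 k) - θ k‖ < σ * Δ / (16 * V) := by
    simpa [atypical] using hω
  have hdist := norm_sub_le_of_hasSubgaussianMGF hσ hs hs0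
  -- The basin radius `Δ / (2L)` is chosen so that the drift of `rho` uses up half of the margin.
  have hrho : |rho σ φ (θ k) ϑ - rho σ φ (θ k) θ₀| ≤ Δ / 2 := by
    have h1 := (hreg k).2.dist_le_mul _ hϑ _ h0
    rw [Real.dist_eq, dist_eq_norm] at h1
    refine h1.trans ((mul_le_mul_of_nonneg_left hϑ' hL'.le).trans (le_of_eq ?_))
    field_simp
  -- The threshold `σΔ / (16V)` in `atypical` is matched to `‖ϑ - θ₀‖ ≤ 2Vσ`: their product is `σ²Δ
  -- / 8`. The three errors then add up to `1/8 + 1/8 + 1/2 = 3/4` of `N Δ`.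
  have hinn : |N * (inner ℝ (sampleMean (ω.2 k) - θ k) (ϑ - θ₀) / σ ^ 2)| ≤ N * Δ / 8 := by
    rw [abs_mul, abs_of_pos hN', abs_div, abs_of_pos (by positivity : 0 < σ ^ 2), mul_div_assoc]
    refine mul_le_mul_of_nonneg_left ?_ hN'.le
    rw [div_le_iff₀ (by positivity)]
    calc |inner ℝ (sampleMean (ω.2 k) - θ k) (ϑ - θ₀)|
        ≤ ‖sampleMean (ω.2 k) - θ k‖ * ‖ϑ - θ₀‖ := abs_real_inner_le_norm _ _
      _ ≤ σ * Δ / (16 * V) * (2 * V * σ) :=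
          mul_le_mul hω2.le hdist (norm_nonneg _) ((norm_nonneg _).trans hω2.le)
      _ = Δ / 8 * σ ^ 2 := by field_simp; ring
  have hsum : ∑ i, logLR σ φ ϑ (ω.2 k i) - N * rho σ φ (θ k) θ₀
      = ∑ i, (logLR σ φ θ₀ (ω.2 k i) - rho σ φ (θ k) θ₀)
        + N * (inner ℝ (sampleMean (ω.2 k) - θ k) (ϑ - θ₀) / σ ^ 2)
        + N * (rho σ φ (θ k) ϑ - rho σ φ (θ k) θ₀) := by
    have h1 : ∀ i, logLR σ φ ϑ (ω.2 k i) = (logLR σ φ θ₀ (ω.2 k i) - rho σ φ (θ k) θ₀)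
        + inner ℝ (ω.2 k i - θ k) (ϑ - θ₀) / σ ^ 2 + rho σ φ (θ k) ϑ := by
      intro i
      have := logLR_sub_rho hσ hi hi0 (ω.2 k i)
      linarith
    simp_rw [h1]
    rw [Finset.sum_add_distrib, Finset.sum_add_distrib, ← Finset.sum_div, ← sum_inner,
      sum_sub_eq_smul_sampleMean_sub hN, real_inner_smul_left]
    simp
    ring
  have hr2 : |N * (rho σ φ (θ k) ϑ - rho σ φ (θ k) θ₀)| ≤ N * (Δ / 2) := by
    rw [abs_mul, abs_of_pos hN']
    exact mul_le_mul_of_nonneg_left hrho hN'.le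
  rw [hsum]
  refine (abs_add_three _ _ _).trans ?_
  linarith

/-- A deviation of `3/4 N Δ` leaves the log-likelihood sum on the correct side of 0 by `N Δ / 4`.
The sigmoid is bounded by the exponential, after the reflection `1 - sg z = sg (-z)` for relevant
sources. -/
lemma abs_emWeight_sub_le (hσ : 0 < σ) [IsProbabilityMeasure φ] {θ₀ : Vec d}
    {θ : Fin K → Vec d} {V L : ℝ≥0} {U : Set (Vec d)} {Δ β : ℝ} (hV : 0 < V) (hL : 0 < L)
    (hβ : 0 < β) (hN : 0 < N) (hU : U ∈ 𝓝 θ₀) (hreg : RegularOn σ φ V L U θ)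
    {R : Finset (Fin K)} (hmar : HasMargin σ φ θ₀ R Δ θ) (p : Fin K → ℝ) {k : Fin K}
    {ω : Data d K N₀ N} (hω : ω ∉ atypical σ φ Δ V θ₀ θ k) {ϑ : Vec d} (hϑ : ϑ ∈ U)
    (hϑ' : ‖ϑ - θ₀‖ ≤ 1 / 2 * Δ / L) :
    |emWeight σ φ β (p k) (ω.2 k) ϑ - if k ∈ R then 1 else 0|
      ≤ Real.exp (logitBound p - β * (N * Δ / 4)) := by
  have h1 := abs_le.1 (abs_sum_logLR_sub_le hσ hV hL hN hU hreg hω hϑ hϑ')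
  have h2 := abs_le.1 (abs_log_le_logitBound p k)
  have hN' : (0 : ℝ) < N := by exact_mod_cast hN
  by_cases hk : k ∈ R
  · have h3 := mul_le_mul_of_nonneg_left ((hmar k).1 hk) hN'.le
    have h4 : β * (N * Δ / 4) ≤ β * ∑ i, logLR σ φ ϑ (ω.2 k i) :=
      mul_le_mul_of_nonneg_left (by linarith) hβ.le
    rw [if_pos hk, abs_sub_comm, emWeight, ← Real.sigmoid_neg, abs_of_nonneg
      (Real.sigmoid_nonneg _)]
    refine (sigmoid_le_exp _).trans (Real.exp_le_exp.2 ?_)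
    linarith
  · have h3 := mul_le_mul_of_nonneg_left ((hmar k).2 hk) hN'.le
    have h4 : β * ∑ i, logLR σ φ ϑ (ω.2 k i) ≤ β * -(N * Δ / 4) :=
      mul_le_mul_of_nonneg_left (by linarith) hβ.le
    rw [if_neg hk, sub_zero, emWeight, abs_of_nonneg (Real.sigmoid_nonneg _)]
    refine (sigmoid_le_exp _).trans (Real.exp_le_exp.2 ?_)
    linarith

/-- The error of the limit of the iterates on the basin event, given an error bound on the
weights in the basin. -/
lemma norm_lim_sub_le (hN₀ : 0 < N₀) {β r : ℝ} {p : Fin K → ℝ} {θ₀ : Vec d}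
    {θinit θlim : Data d K N₀ N → Vec d} {ω : Data d K N₀ N}
    (hω : ω ∈ basinEvent σ φ β p θ₀ r θinit θlim) (R : Finset (Fin K)) {ε : ℝ}
    (hε : ∀ ϑ, ‖ϑ - θ₀‖ ≤ r → ∀ k,
      |emWeight σ φ β (p k) (ω.2 k) ϑ - if k ∈ R then 1 else 0| ≤ ε) {o : Vec d}
    (ho : o = oracleMean N₀ N R (sampleMean ω.1 - θ₀) fun k => sampleMean (ω.2 k) - θ₀) :
    ‖θlim ω - θ₀‖ ≤ ‖o‖ + (N : ℝ) / N₀ * (ε * ∑ k, ‖sampleMean (ω.2 k) - θ₀ - o‖) := by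
  obtain ⟨⟨t₀, ht₀⟩, hlim⟩ := hω
  have h1 : Tendsto (fun t => ‖emIterate σ φ β p ω (θinit ω) (t + 1) - θ₀‖) atTop
      (𝓝 ‖θlim ω - θ₀‖) :=
    (((tendsto_add_atTop_iff_nat 1).2 hlim).sub_const θ₀).norm
  -- Every iterate `t + 1` with `t ≥ t₀` is the image of a point of the basin, so the bound holds
  -- along the tail and passes to the limit. The fixed-point equation is not needed.
  refine le_of_tendsto h1 (eventually_atTop.2 ⟨t₀, fun t ht => ?_⟩)
  have h2 : emIterate σ φ β p ω (θinit ω) (t + 1)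
      = emStep σ φ β p ω (emIterate σ φ β p ω (θinit ω) t) :=
    Function.iterate_succ_apply' _ _ _
  rw [h2, emStep_sub β p ω hN₀, ho]
  exact norm_weightedMean_le (by exact_mod_cast hN₀) (Nat.cast_nonneg _) R _ _
    (fun k => Real.sigmoid_nonneg _) (hε _ (ht₀ t ht))

lemma abs_emWeight_sub_le_one (β q : ℝ) (x : Fin N → Vec d) (ϑ : Vec d) (P : Prop) [Decidable P] :
    |emWeight σ φ β q x ϑ - if P then 1 else 0| ≤ 1 := by
  have h1 : 0 ≤ emWeight σ φ β q x ϑ := Real.sigmoid_nonneg _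
  have h2 : emWeight σ φ β q x ϑ ≤ 1 := Real.sigmoid_le_one _
  split_ifs <;> rw [abs_le] <;> constructor <;> linarith

/-- The factor `6 K` is 2 from squaring a sum of two terms, `K` from Cauchy–Schwarz over the sources
and 3 from the triangle inequality through `θ k`. -/
lemma sq_add_mul_sum_norm_le {x c ε : ℝ} {o : Vec d} {θ₀ : Vec d} {e θ : Fin K → Vec d}
    (hx : 0 ≤ x) (h : x ≤ ‖o‖ + c * (ε * ∑ k, ‖e k - θ₀ - o‖)) :
    x ^ 2 ≤ 2 * ‖o‖ ^ 2 + 6 * K * c ^ 2 * ε ^ 2 *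
      ∑ k, (‖θ k - θ₀‖ ^ 2 + ‖e k - θ k‖ ^ 2 + ‖o‖ ^ 2) := by
  have h1 : ∀ k, ‖e k - θ₀ - o‖ ^ 2
      ≤ 3 * (‖θ k - θ₀‖ ^ 2 + ‖e k - θ k‖ ^ 2 + ‖o‖ ^ 2) := by
    intro k
    have h2 : ‖e k - θ₀ - o‖ ≤ ‖θ k - θ₀‖ + ‖e k - θ k‖ + ‖o‖ := by
      have : e k - θ₀ - o = (θ k - θ₀) + (e k - θ k) - o := by abel
      rw [this]
      exact (norm_sub_le _ _).trans (by gcongr; exact norm_add_le _ _)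
    have h3 := pow_le_pow_left₀ (norm_nonneg _) h2 2
    nlinarith [sq_nonneg (‖θ k - θ₀‖ - ‖e k - θ k‖), sq_nonneg (‖θ k - θ₀‖ - ‖o‖),
      sq_nonneg (‖e k - θ k‖ - ‖o‖)]
  have h4 : (∑ k, ‖e k - θ₀ - o‖) ^ 2
      ≤ K * ∑ k, 3 * (‖θ k - θ₀‖ ^ 2 + ‖e k - θ k‖ ^ 2 + ‖o‖ ^ 2) := by
    have := sq_sum_le_card_mul_sum_sq (s := Finset.univ) (f := fun k => ‖e k - θ₀ - o‖)
    rw [Finset.card_univ, Fintype.card_fin] at this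
    exact this.trans (mul_le_mul_of_nonneg_left (Finset.sum_le_sum fun k _ => h1 k)
      (Nat.cast_nonneg _))
  rw [← Finset.mul_sum] at h4
  have h5 := pow_le_pow_left₀ hx h 2
  have h6 := mul_le_mul_of_nonneg_left h4 (mul_nonneg (sq_nonneg c) (sq_nonneg ε))
  nlinarith [sq_nonneg (‖o‖ - c * (ε * ∑ k, ‖e k - θ₀ - o‖))]

end EM

/-! ### Moments of the estimation errors and the probability of atypical samples. -/

section Moments

lemma setLIntegral_ofReal_le_sqrt {Ω : Type*} [MeasurableSpace Ω] {μ : Measure Ω} {Y : Ω → ℝ}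
    (hY : Measurable Y) (hY0 : ∀ ω, 0 ≤ Y ω) {S : Set Ω} {m P : ℝ} (hm : 0 ≤ m) (hP : 0 ≤ P)
    (h2 : ∫⁻ ω, ENNReal.ofReal (Y ω ^ 2) ∂μ ≤ ENNReal.ofReal m) (hS : μ S ≤ ENNReal.ofReal P) :
    ∫⁻ ω in S, ENNReal.ofReal (Y ω) ∂μ ≤ ENNReal.ofReal (√(m * P)) := by
  have h := ENNReal.lintegral_mul_le_Lp_mul_Lq (μ.restrict S) Real.HolderConjugate.two_two
    (f := fun ω => ENNReal.ofReal (Y ω)) (g := fun _ => 1) (by fun_prop) (by fun_prop)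
  simp only [Pi.mul_apply, mul_one, ENNReal.one_rpow, lintegral_const, Measure.restrict_apply_univ,
    one_mul] at h
  have hsq : ∀ ω, ENNReal.ofReal (Y ω) ^ (2 : ℝ) = ENNReal.ofReal (Y ω ^ 2) := by
    intro ω
    rw [ENNReal.ofReal_rpow_of_nonneg (hY0 ω) two_pos.le, Real.rpow_two]
  simp_rw [hsq] at h
  refine h.trans ?_
  rw [Real.sqrt_eq_rpow, Real.mul_rpow hm hP, ENNReal.ofReal_mul (by positivity),
    ← ENNReal.ofReal_rpow_of_nonneg hm (by norm_num),
    ← ENNReal.ofReal_rpow_of_nonneg hP (by norm_num)]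
  gcongr
  exact (setLIntegral_le_lintegral _ _).trans h2

variable {d K N₀ N : ℕ} {σ : ℝ} {φ : Measure (Vec d)}

lemma sampleMean_sub_eq_noise (hN : 0 < N) (θ₀ : Vec d) (θ : Fin K → Vec d) (k : Fin K)
    (ω : Data d K N₀ N) :
    sampleMean (ω.2 k) - θ k = noise θ₀ θ 0 (Pi.single k (N : ℝ)⁻¹) ω := by
  have hN' : (N : ℝ) ≠ 0 := by exact_mod_cast hN.ne'
  rw [noise, zero_smul, zero_add, Finset.sum_eq_single k (fun j _ hj => by simp [hj]) (by simp),
    sum_sub_eq_smul_sampleMean_sub hN, Pi.single_eq_same, inv_smul_smul₀ hN']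

lemma map_sampleMean_sub (hN : 0 < N) (θ₀ : Vec d) (θ : Fin K → Vec d) (k : Fin K) :
    (dataLaw N₀ N σ θ₀ θ).map (fun ω => sampleMean (ω.2 k) - θ k)
      = gaussLaw (σ / √N) 0 := by
  have hN' : (N : ℝ) ≠ 0 := by exact_mod_cast hN.ne'
  simp_rw [sampleMean_sub_eq_noise hN θ₀]
  refine map_noise σ θ₀ θ _ _ _ ?_
  rw [div_pow, Real.sq_sqrt (Nat.cast_nonneg _), Finset.sum_eq_single k
    (fun j _ hj => by simp [hj]) (by simp), Pi.single_eq_same]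
  field_simp
  ring

/-- The error of the oracle estimator, which pools the target and the relevant sources. -/
noncomputable def oracleError (R : Finset (Fin K)) (θ₀ : Vec d) (ω : Data d K N₀ N) : Vec d :=
  oracleMean N₀ N R (sampleMean ω.1 - θ₀) fun k => sampleMean (ω.2 k) - θ₀

lemma measurable_oracleError (R : Finset (Fin K)) (θ₀ : Vec d) :
    Measurable (oracleError (N₀ := N₀) (N := N) R θ₀) := by
  unfold oracleError oracleMean sampleMean; fun_prop

/-- Relevant sources share the mean `θ₀`, so the oracle is the unbiased mean of `N₀ + N |R|`
observations. -/
lemma map_oracleError (hN₀ : 0 < N₀) (hN : 0 < N) {R : Finset (Fin K)} {θ₀ : Vec d}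
    {θ : Fin K → Vec d} (hθ : ∀ k ∈ R, θ k = θ₀) :
    (dataLaw N₀ N σ θ₀ θ).map (oracleError R θ₀)
      = gaussLaw (σ / √(N₀ + N * R.card)) 0 := by
  have hN' : (N : ℝ) ≠ 0 := by exact_mod_cast hN.ne'
  have hN₀' : (0 : ℝ) < N₀ := by exact_mod_cast hN₀
  have hW : (0 : ℝ) < N₀ + N * R.card := by positivity
  have h : oracleError (N₀ := N₀) (N := N) R θ₀ = noise θ₀ θ (N₀ + N * R.card : ℝ)⁻¹
      fun k => if k ∈ R then (N₀ + N * R.card : ℝ)⁻¹ else 0 := by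
    funext ω
    simp only [oracleError, oracleMean, noise, sum_sub_eq_smul_sampleMean_sub hN,
      sum_sub_eq_smul_sampleMean_sub hN₀, smul_add, ite_smul, zero_smul, Finset.sum_ite_mem,
      Finset.univ_inter, Finset.smul_sum]
    congr 1
    exact Finset.sum_congr rfl fun k hk => by rw [hθ k hk]
  rw [h]
  refine map_noise σ θ₀ θ _ _ _ ?_
  rw [div_pow, Real.sq_sqrt hW.le]
  simp only [ite_pow, zero_pow two_ne_zero, Finset.sum_ite_mem, Finset.univ_inter,
    Finset.sum_const, nsmul_eq_mul]
  field_simp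

lemma lintegral_comp_of_map_eq {Ω : Type*} [MeasurableSpace Ω] {μ : Measure Ω} {X : Ω → Vec d}
    {ν : Measure (Vec d)} (hX : Measurable X) (h : μ.map X = ν) (n : ℕ) :
    ∫⁻ ω, ENNReal.ofReal (‖X ω‖ ^ n) ∂μ = ∫⁻ x, ENNReal.ofReal (‖x‖ ^ n) ∂ν := by
  rw [← h, lintegral_map (by fun_prop) hX]

lemma measurableSet_atypical [SFinite φ] (Δ V : ℝ) (θ₀ : Vec d) (θ : Fin K → Vec d) (k : Fin K) :
    MeasurableSet (atypical (N₀ := N₀) (N := N) σ φ Δ V θ₀ θ k) := by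
  have h1 : Measurable fun ω : Data d K N₀ N =>
      |∑ i, (logLR σ φ θ₀ (ω.2 k i) - rho σ φ (θ k) θ₀)| := by
    have h : ∀ i, Measurable fun ω : Data d K N₀ N => logLR σ φ θ₀ (ω.2 k i) := fun i =>
      (measurable_logLR θ₀).comp (by fun_prop)
    fun_prop
  have h2 : Measurable fun ω : Data d K N₀ N => ‖sampleMean (ω.2 k) - θ k‖ := by
    unfold sampleMean; fun_prop
  exact (measurableSet_le measurable_const h1).union (measurableSet_le measurable_const h2)

lemma dataLaw_atypical_le (hσ : 0 < σ) [IsProbabilityMeasure φ] {H : ℝ} (hH0 : 0 ≤ H)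
    (hH : ∀ t : ℝ, 0 ≤ t →
      stdGaussian (Vec d) {x | t ≤ ‖x‖} ≤ ENNReal.ofReal (H * Real.exp (-(t ^ 2 / 4))))
    {θ₀ : Vec d} {θ : Fin K → Vec d} {V : ℝ≥0} {Δ : ℝ} (hΔ : 0 < Δ) (hV : 0 < V) (hN : 0 < N)
    {k : Fin K}
    (hs : HasSubgaussianMGF (fun x => logLR σ φ θ₀ x - rho σ φ (θ k) θ₀) (V ^ 2)
      (gaussLaw σ (θ k))) :
    dataLaw N₀ N σ θ₀ θ (atypical σ φ Δ V θ₀ θ k)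
      ≤ ENNReal.ofReal ((2 + H) * Real.exp (-(1 / 1024 * (N * Δ ^ 2 / V ^ 2)))) := by
  have hN' : (0 : ℝ) < N := by exact_mod_cast hN
  have hV' : (0 : ℝ) < V := hV
  have h1 := dataLaw_abs_sum_ge_le (N₀ := N₀) (N := N) (θ₀ := θ₀)
    ((measurable_logLR θ₀).sub_const _) hs (t := N * Δ / 8) (by positivity)
  have h2 : dataLaw N₀ N σ θ₀ θ {ω | σ * Δ / (16 * V) ≤ ‖sampleMean (ω.2 k) - θ k‖}
      ≤ ENNReal.ofReal (H * Real.exp (-(1 / 1024 * (N * Δ ^ 2 / V ^ 2)))) := by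
    have hm : Measurable fun ω : Data d K N₀ N => sampleMean (ω.2 k) - θ k := by
      unfold sampleMean; fun_prop
    -- The exponent is `(σΔ / (16V))² / (4σ² / N) = N Δ² / (1024 V²)`. It is weaker than the `1/128`
    -- of the log-likelihood sum and hence governs the union.
    have h3 := gaussLaw_norm_tail_le hH (s := σ / √N) (t := σ * Δ / (16 * V)) (by positivity)
      (by positivity)
    rw [← map_sampleMean_sub (N₀ := N₀) hN θ₀ θ k, Measure.map_apply hm
      (measurableSet_le measurable_const measurable_norm)] at h3
    refine h3.trans (le_of_eq ?_)
    congr 4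
    rw [div_pow, div_pow, Real.sq_sqrt hN'.le]
    field_simp
    norm_num
  refine (measure_union_le _ _).trans ((add_le_add h1 h2).trans ?_)
  rw [← ENNReal.ofReal_add (by positivity) (by positivity), add_mul]
  refine ENNReal.ofReal_le_ofReal (add_le_add_left (mul_le_mul_of_nonneg_left
    (Real.exp_le_exp.2 (neg_le_neg ?_)) two_pos.le) _)
  have : (N * Δ / 8) ^ 2 / (2 * N * (V : ℝ) ^ 2) = 1 / 128 * (N * Δ ^ 2 / V ^ 2) := by
    field_simp
    norm_num
  rw [this]
  have : 0 ≤ N * Δ ^ 2 / (V : ℝ) ^ 2 := by positivity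
  linarith

/-- The squared distance of the source estimate `k` from the oracle, up to a factor `3`. -/
noncomputable def spread (R : Finset (Fin K)) (θ₀ : Vec d) (θ : Fin K → Vec d) (k : Fin K)
    (ω : Data d K N₀ N) : ℝ :=
  ‖θ k - θ₀‖ ^ 2 + ‖sampleMean (ω.2 k) - θ k‖ ^ 2 + ‖oracleError R θ₀ ω‖ ^ 2

lemma spread_nonneg (R : Finset (Fin K)) (θ₀ : Vec d) (θ : Fin K → Vec d) (k : Fin K)
    (ω : Data d K N₀ N) : 0 ≤ spread R θ₀ θ k ω := by
  unfold spread; positivity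

lemma measurable_norm_sampleMean_sub (θ : Fin K → Vec d) (k : Fin K) :
    Measurable fun ω : Data d K N₀ N => ‖sampleMean (ω.2 k) - θ k‖ := by
  unfold sampleMean; fun_prop

lemma measurable_spread (R : Finset (Fin K)) (θ₀ : Vec d) (θ : Fin K → Vec d) (k : Fin K) :
    Measurable (spread (N₀ := N₀) (N := N) R θ₀ θ k) := by
  have h1 := measurable_oracleError (N₀ := N₀) (N := N) R θ₀
  have h2 := measurable_norm_sampleMean_sub (N₀ := N₀) (N := N) θ k
  unfold spread
  fun_prop

lemma lintegral_norm_sampleMean_sub_sq (hN : 0 < N) (θ₀ : Vec d) (θ : Fin K → Vec d) (k : Fin K) :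
    ∫⁻ ω, ENNReal.ofReal (‖sampleMean (ω.2 k) - θ k‖ ^ 2) ∂(dataLaw N₀ N σ θ₀ θ)
      = ENNReal.ofReal (d * σ ^ 2 / N) := by
  rw [lintegral_comp_of_map_eq (X := fun ω : Data d K N₀ N => sampleMean (ω.2 k) - θ k)
    (by unfold sampleMean; fun_prop) (map_sampleMean_sub hN θ₀ θ k), lintegral_norm_sq_gaussLaw,
    div_pow, Real.sq_sqrt (Nat.cast_nonneg _), mul_div_assoc]

lemma lintegral_norm_oracleError_sq (hN₀ : 0 < N₀) (hN : 0 < N) {R : Finset (Fin K)} {θ₀ : Vec d}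
    {θ : Fin K → Vec d} (hθ : ∀ k ∈ R, θ k = θ₀) :
    ∫⁻ ω : Data d K N₀ N, ENNReal.ofReal (‖oracleError R θ₀ ω‖ ^ 2) ∂(dataLaw N₀ N σ θ₀ θ)
      = ENNReal.ofReal (d * σ ^ 2 / (N₀ + N * R.card)) := by
  rw [lintegral_comp_of_map_eq (measurable_oracleError R θ₀) (map_oracleError hN₀ hN hθ),
    lintegral_norm_sq_gaussLaw, div_pow, Real.sq_sqrt (by positivity), mul_div_assoc]

lemma lintegral_spread_le (hN₀ : 0 < N₀) (hN : 0 < N) {R : Finset (Fin K)} {θ₀ : Vec d}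
    {θ : Fin K → Vec d} (hθ : ∀ k ∈ R, θ k = θ₀) {k : Fin K} {A v : ℝ}
    (hv : d * σ ^ 2 / N ≤ v) (h1 : ‖θ k - θ₀‖ ^ 2 ≤ A * v)
    (h2 : d * σ ^ 2 / (N₀ + N * R.card) ≤ A * v) :
    ∫⁻ ω : Data d K N₀ N, ENNReal.ofReal (spread R θ₀ θ k ω) ∂(dataLaw N₀ N σ θ₀ θ)
      ≤ ENNReal.ofReal ((2 * A + 1) * v) := by
  have hm1 := measurable_oracleError (N₀ := N₀) (N := N) R θ₀
  have hm2 := measurable_norm_sampleMean_sub (N₀ := N₀) (N := N) θ k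
  have h : ∀ ω : Data d K N₀ N, ENNReal.ofReal (spread R θ₀ θ k ω)
      = ENNReal.ofReal (‖θ k - θ₀‖ ^ 2) + ENNReal.ofReal (‖sampleMean (ω.2 k) - θ k‖ ^ 2)
        + ENNReal.ofReal (‖oracleError R θ₀ ω‖ ^ 2) := by
    intro ω
    rw [spread, ENNReal.ofReal_add (by positivity) (by positivity),
      ENNReal.ofReal_add (by positivity) (by positivity)]
  simp_rw [h]
  rw [lintegral_add_left (by fun_prop), lintegral_add_left (by fun_prop), lintegral_const,
    measure_univ, mul_one, lintegral_norm_sampleMean_sub_sq hN,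
    lintegral_norm_oracleError_sq hN₀ hN hθ, ← ENNReal.ofReal_add (by positivity) (by positivity),
    ← ENNReal.ofReal_add (by positivity) (by positivity)]
  exact ENNReal.ofReal_le_ofReal (by linarith)

lemma lintegral_spread_sq_le (hd : 0 < d) (hN₀ : 0 < N₀) (hN : 0 < N) {M : ℝ} (hM0 : 0 ≤ M)
    (hM : ∫⁻ x, ENNReal.ofReal (‖x‖ ^ 4) ∂(stdGaussian (Vec d)) ≤ ENNReal.ofReal M)
    {R : Finset (Fin K)} {θ₀ : Vec d}
    {θ : Fin K → Vec d} (hθ : ∀ k ∈ R, θ k = θ₀) {k : Fin K} {A v : ℝ}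
    (hv : d * σ ^ 2 / N ≤ v) (h1 : ‖θ k - θ₀‖ ^ 2 ≤ A * v)
    (h2 : d * σ ^ 2 / (N₀ + N * R.card) ≤ A * v) :
    ∫⁻ ω : Data d K N₀ N, ENNReal.ofReal (spread R θ₀ θ k ω ^ 2) ∂(dataLaw N₀ N σ θ₀ θ)
      ≤ ENNReal.ofReal (3 * (A ^ 2 + M + M * A ^ 2) * v ^ 2) := by
  have hd' : (1 : ℝ) ≤ d := by exact_mod_cast hd
  have hN₀' : (0 : ℝ) < N₀ := by exact_mod_cast hN₀
  have hN' : (0 : ℝ) < N := by exact_mod_cast hN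
  have hm1 := measurable_oracleError (N₀ := N₀) (N := N) R θ₀
  have hm2 := measurable_norm_sampleMean_sub (N₀ := N₀) (N := N) θ k
  -- The fourth moments scale as `(σ² / w)²`; `d ≥ 1` allows `σ² / w` to be replaced by the second
  -- moment `d σ² / w`.
  have hpow : ∀ {w x : ℝ}, 0 < w → d * σ ^ 2 / w ≤ x → M * (σ / √w) ^ 4 ≤ M * x ^ 2 := by
    intro w x hw hx
    have h3 : (σ / √w) ^ 4 = (σ ^ 2 / w) ^ 2 := by
      rw [show 4 = 2 * 2 from rfl, pow_mul, div_pow, Real.sq_sqrt hw.le]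
    have h4 : σ ^ 2 / w ≤ x := by
      refine le_trans ?_ hx
      gcongr
      nlinarith [sq_nonneg σ]
    rw [h3]
    gcongr
  have h : ∀ ω : Data d K N₀ N, ENNReal.ofReal (spread R θ₀ θ k ω ^ 2)
      ≤ 3 * (ENNReal.ofReal (‖θ k - θ₀‖ ^ 4) + ENNReal.ofReal (‖sampleMean (ω.2 k) - θ k‖ ^ 4)
        + ENNReal.ofReal (‖oracleError R θ₀ ω‖ ^ 4)) := by
    intro ω
    rw [← ENNReal.ofReal_add (by positivity) (by positivity),
      ← ENNReal.ofReal_add (by positivity) (by positivity),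
      ← ENNReal.ofReal_ofNat 3, ← ENNReal.ofReal_mul (by norm_num)]
    refine ENNReal.ofReal_le_ofReal ?_
    rw [spread]
    nlinarith [sq_nonneg (‖θ k - θ₀‖ ^ 2 - ‖sampleMean (ω.2 k) - θ k‖ ^ 2),
      sq_nonneg (‖θ k - θ₀‖ ^ 2 - ‖oracleError R θ₀ ω‖ ^ 2),
      sq_nonneg (‖sampleMean (ω.2 k) - θ k‖ ^ 2 - ‖oracleError R θ₀ ω‖ ^ 2)]
  refine (lintegral_mono h).trans ?_
  rw [lintegral_const_mul _ (by fun_prop), lintegral_add_left (by fun_prop),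
    lintegral_add_left (by fun_prop), lintegral_const, measure_univ, mul_one]
  have e1 : ENNReal.ofReal (‖θ k - θ₀‖ ^ 4) ≤ ENNReal.ofReal (A ^ 2 * v ^ 2) := by
    refine ENNReal.ofReal_le_ofReal ?_
    have := pow_le_pow_left₀ (by positivity) h1 2
    calc ‖θ k - θ₀‖ ^ 4 = (‖θ k - θ₀‖ ^ 2) ^ 2 := by ring
      _ ≤ (A * v) ^ 2 := this
      _ = A ^ 2 * v ^ 2 := by ring
  have e2 : ∫⁻ ω, ENNReal.ofReal (‖sampleMean (ω.2 k) - θ k‖ ^ 4) ∂(dataLaw N₀ N σ θ₀ θ)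
      ≤ ENNReal.ofReal (M * v ^ 2) := by
    rw [lintegral_comp_of_map_eq (X := fun ω : Data d K N₀ N => sampleMean (ω.2 k) - θ k)
      (by unfold sampleMean; fun_prop) (map_sampleMean_sub hN θ₀ θ k)]
    exact (lintegral_norm_pow_four_gaussLaw_le hM _).trans
      (ENNReal.ofReal_le_ofReal (hpow hN' hv))
  have e3 : ∫⁻ ω : Data d K N₀ N, ENNReal.ofReal (‖oracleError R θ₀ ω‖ ^ 4)
        ∂(dataLaw N₀ N σ θ₀ θ)
      ≤ ENNReal.ofReal (M * A ^ 2 * v ^ 2) := by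
    rw [lintegral_comp_of_map_eq (measurable_oracleError R θ₀) (map_oracleError hN₀ hN hθ)]
    exact (lintegral_norm_pow_four_gaussLaw_le hM _).trans
      (ENNReal.ofReal_le_ofReal ((hpow (by positivity) h2).trans (le_of_eq (by ring))))
  refine (mul_le_mul_right (add_le_add (add_le_add e1 e2) e3) _).trans (le_of_eq ?_)
  rw [← ENNReal.ofReal_add (by positivity) (by positivity),
    ← ENNReal.ofReal_add (by positivity) (by positivity),
    ← ENNReal.ofReal_ofNat 3, ← ENNReal.ofReal_mul (by norm_num)]
  congr 1
  ring

end Moments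

/-! ### The error bound for fixed source parameters. -/

section Conditional

variable {d K N₀ N : ℕ} {σ : ℝ} {φ : Measure (Vec d)}

lemma sq_norm_lim_sub_le (hN₀ : 0 < N₀) {β r : ℝ} {p : Fin K → ℝ} {θ₀ : Vec d}
    {θinit θlim : Data d K N₀ N → Vec d} {ω : Data d K N₀ N}
    (hω : ω ∈ basinEvent σ φ β p θ₀ r θinit θlim) (R : Finset (Fin K)) (θ : Fin K → Vec d) {ε : ℝ}
    (hε : ∀ ϑ, ‖ϑ - θ₀‖ ≤ r → ∀ k,
      |emWeight σ φ β (p k) (ω.2 k) ϑ - if k ∈ R then 1 else 0| ≤ ε) :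
    ‖θlim ω - θ₀‖ ^ 2 ≤ 2 * ‖oracleError R θ₀ ω‖ ^ 2
      + 6 * K * ((N : ℝ) / N₀) ^ 2 * ε ^ 2 * ∑ k, spread R θ₀ θ k ω :=
  sq_add_mul_sum_norm_le (e := fun k => sampleMean (ω.2 k)) (norm_nonneg _)
    (norm_lim_sub_le hN₀ hω R hε rfl)

/-- The conditional error bound for given source parameters, in terms of a common bound `A * v`
on the squared distances of the sources and on the oracle error. -/
lemma setLIntegral_basinEvent_le (hd : 0 < d) (hσ : 0 < σ) [IsProbabilityMeasure φ]
    (hN₀ : 0 < N₀) (hN : 0 < N) {M H A v : ℝ} (hM0 : 0 ≤ M)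
    (hM : ∫⁻ x, ENNReal.ofReal (‖x‖ ^ 4) ∂(stdGaussian (Vec d)) ≤ ENNReal.ofReal M)
    (hH0 : 0 ≤ H)
    (hH : ∀ t : ℝ, 0 ≤ t →
      stdGaussian (Vec d) {x | t ≤ ‖x‖} ≤ ENNReal.ofReal (H * Real.exp (-(t ^ 2 / 4))))
    {R : Finset (Fin K)} {p : Fin K → ℝ} {β Δ : ℝ} {V L : ℝ≥0} {U : Set (Vec d)} {θ₀ : Vec d}
    {θ : Fin K → Vec d} (θinit θlim : Data d K N₀ N → Vec d)
    (hβ : 0 < β) (hΔ : 0 < Δ) (hV : 0 < V) (hL : 0 < L) (hU : U ∈ 𝓝 θ₀)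
    (hUball : Metric.closedBall θ₀ (1 / 2 * Δ / L) ⊆ U) (hreg : RegularOn σ φ V L U θ)
    (hmar : HasMargin σ φ θ₀ R Δ θ) (hθ : ∀ k ∈ R, θ k = θ₀) (hA : 0 ≤ A)
    (hv : d * σ ^ 2 / N ≤ v) (h1 : ∀ k, ‖θ k - θ₀‖ ^ 2 ≤ A * v)
    (h2 : ∀ _k : Fin K, d * σ ^ 2 / (N₀ + N * R.card) ≤ A * v) :
    ∫⁻ ω in basinEvent σ φ β p θ₀ (1 / 2 * Δ / L) θinit θlim,
        ENNReal.ofReal (‖θlim ω - θ₀‖ ^ 2) ∂(dataLaw N₀ N σ θ₀ θ)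
      ≤ ENNReal.ofReal (2 * (d * σ ^ 2 / (N₀ + N * R.card))
        + 6 * K * ((N : ℝ) / N₀) ^ 2 * (Real.exp (logitBound p - β * (N * Δ / 4)) ^ 2 *
            (K * ((2 * A + 1) * v))
          + K * √(3 * (A ^ 2 + M + M * A ^ 2) * v ^ 2 *
            (K * ((2 + H) * Real.exp (-(1 / 1024 * (N * Δ ^ 2 / V ^ 2)))))))) := by
  set ε := Real.exp (logitBound p - β * (N * Δ / 4))
  set c : ℝ := 6 * K * ((N : ℝ) / N₀) ^ 2
  set P : ℝ := K * ((2 + H) * Real.exp (-(1 / 1024 * (N * Δ ^ 2 / V ^ 2))))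
  have hc : 0 ≤ c := by positivity
  have hP : 0 ≤ P := by positivity
  have hv0 : 0 ≤ v := le_trans (by positivity) hv
  set S : Set (Data d K N₀ N) := ⋃ k, atypical σ φ Δ V θ₀ θ k
  have hSm : MeasurableSet S := MeasurableSet.iUnion fun k => measurableSet_atypical Δ V θ₀ θ k
  have hSP : dataLaw N₀ N σ θ₀ θ S ≤ ENNReal.ofReal P := by
    refine (measure_iUnion_fintype_le _ _).trans ((Finset.sum_le_sum fun k _ =>
      dataLaw_atypical_le hσ hH0 hH hΔ hV hN ((hreg k).1 θ₀ (mem_of_mem_nhds hU))).trans ?_)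
    rw [Finset.sum_const, Finset.card_univ, Fintype.card_fin, nsmul_eq_mul,
      ENNReal.ofReal_mul (Nat.cast_nonneg _), ENNReal.ofReal_natCast]
  set Y : Fin K → Data d K N₀ N → ℝ := fun k ω => spread R θ₀ θ k ω
  have hY0 : ∀ k ω, 0 ≤ Y k ω := fun k ω => spread_nonneg ..
  have hYm : ∀ k, Measurable (Y k) := fun k => measurable_spread ..
  have hom := measurable_oracleError (N₀ := N₀) (N := N) R θ₀
  -- A measurable majorant: weight error `ε` everywhere, plus weight error 1 on the atypical set
  -- `S`. It allows the integral to be extended from the basin event to the whole space.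
  set g : Data d K N₀ N → ℝ≥0∞ := fun ω => 2 * ENNReal.ofReal (‖oracleError R θ₀ ω‖ ^ 2)
    + ENNReal.ofReal c * (ENNReal.ofReal (ε ^ 2) * ∑ k, ENNReal.ofReal (Y k ω)
      + ∑ k, S.indicator (fun ω => ENNReal.ofReal (Y k ω)) ω) with hg
  have hgm : Measurable g := by
    have : ∀ k, Measurable (S.indicator fun ω => ENNReal.ofReal (Y k ω)) := fun k =>
      (hYm k).ennreal_ofReal.indicator hSm
    fun_prop
  have hpt : ∀ ω ∈ basinEvent σ φ β p θ₀ (1 / 2 * Δ / L) θinit θlim,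
      ENNReal.ofReal (‖θlim ω - θ₀‖ ^ 2) ≤ g ω := by
    intro ω hω
    have key : ∀ e : ℝ, (∀ ϑ, ‖ϑ - θ₀‖ ≤ 1 / 2 * Δ / L → ∀ k,
        |emWeight σ φ β (p k) (ω.2 k) ϑ - if k ∈ R then 1 else 0| ≤ e) →
        ENNReal.ofReal (‖θlim ω - θ₀‖ ^ 2) ≤ 2 * ENNReal.ofReal (‖oracleError R θ₀ ω‖ ^ 2)
          + ENNReal.ofReal c * (ENNReal.ofReal (e ^ 2) * ∑ k, ENNReal.ofReal (Y k ω)) := by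
      intro e he
      refine (ENNReal.ofReal_le_ofReal (sq_norm_lim_sub_le hN₀ hω R θ he)).trans (le_of_eq ?_)
      rw [ENNReal.ofReal_add (by positivity)
        (mul_nonneg (by positivity) (Finset.sum_nonneg fun k _ => hY0 k ω)),
        ENNReal.ofReal_mul two_pos.le, mul_assoc, ENNReal.ofReal_mul hc,
        ENNReal.ofReal_mul (sq_nonneg e), ENNReal.ofReal_sum_of_nonneg fun k _ => hY0 k ω,
        ENNReal.ofReal_ofNat]
    by_cases hS : ω ∈ S
    · refine (key 1 fun ϑ _ k => abs_emWeight_sub_le_one _ _ _ _ _).trans ?_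
      simp only [hg, Set.indicator_of_mem hS, one_pow, ENNReal.ofReal_one, one_mul]
      gcongr
      exact le_add_self
    · have hω' : ∀ k, ω ∉ atypical σ φ Δ V θ₀ θ k := by simpa [S] using hS
      refine (key ε fun ϑ hϑ k => abs_emWeight_sub_le hσ hV hL hβ hN hU hreg hmar p (hω' k)
        (hUball (by simpa [dist_eq_norm] using hϑ)) hϑ).trans ?_
      simp only [hg]
      gcongr
      exact le_self_add
  refine (setLIntegral_mono hgm hpt).trans ((setLIntegral_le_lintegral _ _).trans ?_)
  have i1 : ∫⁻ ω, ∑ k, ENNReal.ofReal (Y k ω) ∂(dataLaw N₀ N σ θ₀ θ)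
      ≤ ENNReal.ofReal (K * ((2 * A + 1) * v)) := by
    rw [lintegral_finsetSum _ fun k _ => (hYm k).ennreal_ofReal]
    refine (Finset.sum_le_sum fun k _ =>
      lintegral_spread_le hN₀ hN hθ hv (h1 k) (h2 k)).trans (le_of_eq ?_)
    rw [Finset.sum_const, Finset.card_univ, Fintype.card_fin, nsmul_eq_mul,
      ENNReal.ofReal_mul (Nat.cast_nonneg _), ENNReal.ofReal_natCast]
  have i2 : ∫⁻ ω, ∑ k, S.indicator (fun ω => ENNReal.ofReal (Y k ω)) ω ∂(dataLaw N₀ N σ θ₀ θ)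
      ≤ ENNReal.ofReal (K * √(3 * (A ^ 2 + M + M * A ^ 2) * v ^ 2 * P)) := by
    rw [lintegral_finsetSum _ fun k _ => (hYm k).ennreal_ofReal.indicator hSm]
    simp_rw [lintegral_indicator hSm]
    refine (Finset.sum_le_sum fun k _ => setLIntegral_ofReal_le_sqrt (hYm k) (hY0 k)
      (by positivity) hP
      (lintegral_spread_sq_le hd hN₀ hN hM0 hM hθ hv (h1 k) (h2 k)) hSP).trans (le_of_eq ?_)
    rw [Finset.sum_const, Finset.card_univ, Fintype.card_fin, nsmul_eq_mul,
      ENNReal.ofReal_mul (Nat.cast_nonneg _), ENNReal.ofReal_natCast]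
  have hsm : Measurable fun ω => ∑ k, ENNReal.ofReal (Y k ω) := by fun_prop
  have hgi : ∫⁻ ω, g ω ∂(dataLaw N₀ N σ θ₀ θ)
      = 2 * ENNReal.ofReal (d * σ ^ 2 / (N₀ + N * R.card))
        + ENNReal.ofReal c * (ENNReal.ofReal (ε ^ 2)
            * ∫⁻ ω, ∑ k, ENNReal.ofReal (Y k ω) ∂(dataLaw N₀ N σ θ₀ θ)
          + ∫⁻ ω, ∑ k, S.indicator (fun ω => ENNReal.ofReal (Y k ω)) ω
              ∂(dataLaw N₀ N σ θ₀ θ)) := by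
    rw [hg, lintegral_add_left (by fun_prop), lintegral_const_mul _ (by fun_prop),
      lintegral_const_mul' _ _ ENNReal.ofReal_ne_top, lintegral_add_left (by fun_prop),
      lintegral_const_mul _ hsm, lintegral_norm_oracleError_sq hN₀ hN hθ]
  have hA' : 0 ≤ (2 * A + 1) * v := by positivity
  rw [hgi, ENNReal.ofReal_add (by positivity) (by positivity), ENNReal.ofReal_mul two_pos.le,
    ENNReal.ofReal_mul hc, ENNReal.ofReal_add (by positivity) (by positivity),
    ENNReal.ofReal_mul (sq_nonneg ε), ENNReal.ofReal_ofNat]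
  gcongr

/-- The square root halves the exponent `y` and turns the `k` of the union bound into `√k`, whence
`k^(5/2)`. One constant, the sum of the two that arise, serves both terms. -/
lemma error_bound_le {D A M H k r b y n v c₂ : ℝ} (hk : 0 ≤ k) (hv : 0 ≤ v)
    (hA : 0 ≤ A) (hM : 0 ≤ M) (hH : 0 ≤ H) (hy : y = 2 * c₂) :
    2 * D + 6 * k * r ^ 2 * (Real.exp (b - n) ^ 2 * (k * ((2 * A + 1) * v))
        + k * √(3 * (A ^ 2 + M + M * A ^ 2) * v ^ 2 * (k * ((2 + H) * Real.exp (-y)))))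
      ≤ 2 * D + (6 * (2 * A + 1) + 6 * √(3 * (A ^ 2 + M + M * A ^ 2) * (2 + H)))
          * (k ^ 2 * r ^ 2 * v * Real.exp (2 * b)) * Real.exp (-(2 * n))
        + (6 * (2 * A + 1) + 6 * √(3 * (A ^ 2 + M + M * A ^ 2) * (2 + H)))
          * (k ^ (5 / 2 : ℝ) * r ^ 2 * v) * Real.exp (-c₂) := by
  have h1 : Real.exp (b - n) ^ 2 = Real.exp (2 * b) * Real.exp (-(2 * n)) := by
    rw [← Real.exp_nat_mul, ← Real.exp_add]
    congr 1
    push_cast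
    ring
  have h2 : √(3 * (A ^ 2 + M + M * A ^ 2) * v ^ 2 * (k * ((2 + H) * Real.exp (-y))))
      = √(3 * (A ^ 2 + M + M * A ^ 2) * (2 + H)) * v * √k * Real.exp (-c₂) := by
    have : 3 * (A ^ 2 + M + M * A ^ 2) * v ^ 2 * (k * ((2 + H) * Real.exp (-y)))
        = (3 * (A ^ 2 + M + M * A ^ 2) * (2 + H)) * k * (v * Real.exp (-c₂)) ^ 2 := by
      rw [hy, mul_pow, ← Real.exp_nat_mul]
      push_cast
      rw [mul_neg]
      ring
    rw [this, Real.sqrt_mul (by positivity), Real.sqrt_mul (by positivity),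
      Real.sqrt_sq (by positivity)]
    ring
  have h3 : k ^ (5 / 2 : ℝ) = k ^ 2 * √k := by
    rw [Real.sqrt_eq_rpow, ← Real.rpow_natCast, ← Real.rpow_add_of_nonneg hk (by norm_num)
      (by norm_num)]
    norm_num
  rw [h1, h2, h3]
  set Q := √(3 * (A ^ 2 + M + M * A ^ 2) * (2 + H))
  have hQ : 0 ≤ Q := Real.sqrt_nonneg _
  -- `6 * e1` and `6 * e2` are the surplus created by sharing the constant.
  have e1 : 0 ≤ Q * (k ^ 2 * r ^ 2 * v * Real.exp (2 * b)) * Real.exp (-(2 * n)) := by positivity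
  have e2 : 0 ≤ (2 * A + 1) * (k ^ 2 * √k * r ^ 2 * v) * Real.exp (-c₂) := by positivity
  nlinarith

end Conditional

/-! ### Almost sure properties of the prior draw. -/

section Prior

variable {d K : ℕ} {φ : Measure (Vec d)} {θ₀ : Vec d} {R : Finset (Fin K)}

lemma measurePreserving_eval_priorLaw [IsProbabilityMeasure φ] (k : Fin K) :
    MeasurePreserving (fun θ : Fin K → Vec d => θ k) (priorLaw φ θ₀ R)
      (if k ∈ R then Measure.dirac θ₀ else φ) := by
  have (j : Fin K) : IsProbabilityMeasure (if j ∈ R then Measure.dirac θ₀ else φ) := by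
    split_ifs <;> infer_instance
  exact measurePreserving_eval (fun j => if j ∈ R then Measure.dirac θ₀ else φ) k

lemma ae_priorLaw_eq [IsProbabilityMeasure φ] :
    ∀ᵐ θ ∂(priorLaw φ θ₀ R), ∀ k ∈ R, θ k = θ₀ := by
  refine ae_all_iff.2 fun k => ?_
  by_cases hk : k ∈ R
  · have h := measurePreserving_eval_priorLaw (φ := φ) (θ₀ := θ₀) (R := R) k
    rw [if_pos hk] at h
    have h1 : ∀ᵐ x ∂(Measure.dirac θ₀), x = θ₀ := 
      (ae_dirac_iff (measurableSet_singleton θ₀)).2 rfl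
    filter_upwards [h.quasiMeasurePreserving.ae h1] with θ hθ _ using hθ
  · exact ae_of_all _ fun θ h => absurd h hk

lemma ae_priorLaw_of_ae [IsProbabilityMeasure φ] {P : Vec d → Prop} (hP : ∀ᵐ x ∂φ, P x) :
    ∀ᵐ θ ∂(priorLaw φ θ₀ R), ∀ k, k ∉ R → P (θ k) := by
  refine ae_all_iff.2 fun k => ?_
  by_cases hk : k ∈ R
  · exact ae_of_all _ fun θ h => absurd hk h
  · have h := measurePreserving_eval_priorLaw (φ := φ) (θ₀ := θ₀) (R := R) k
    rw [if_neg hk] at h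
    filter_upwards [h.quasiMeasurePreserving.ae hP] with θ hθ _ using hθ

lemma priorLaw_compl_wellSeparated_le [IsProbabilityMeasure φ] {rsep α : ℝ}
    (h : φ {ϑ | ‖ϑ - θ₀‖ < rsep} ≤ ENNReal.ofReal α) :
    priorLaw φ θ₀ R (wellSeparated θ₀ R rsep)ᶜ ≤ ENNReal.ofReal (K * α) := by
  have hsub : (wellSeparated θ₀ R rsep)ᶜ ⊆
      ⋃ k : Fin K, {θ : Fin K → Vec d | k ∉ R ∧ ‖θ k - θ₀‖ < rsep} := by
    intro θ hθ
    simpa [wellSeparated] using hθ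
  have hm : MeasurableSet {ϑ : Vec d | ‖ϑ - θ₀‖ < rsep} :=
    measurableSet_lt (by fun_prop) measurable_const
  refine (measure_mono hsub).trans ((measure_iUnion_fintype_le _ _).trans ?_)
  have hk : ∀ k : Fin K, priorLaw φ θ₀ R {θ : Fin K → Vec d | k ∉ R ∧ ‖θ k - θ₀‖ < rsep}
      ≤ ENNReal.ofReal α := by
    intro k
    by_cases hk : k ∈ R
    · simp [hk]
    · have h1 := measurePreserving_eval_priorLaw (φ := φ) (θ₀ := θ₀) (R := R) k
      rw [if_neg hk] at h1
      have h2 := h1.measure_preimage hm.nullMeasurableSet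
      refine le_trans (measure_mono fun θ hθ => ?_) (h2.le.trans h)
      exact hθ.2
  refine (Finset.sum_le_sum fun k _ => hk k).trans (le_of_eq ?_)
  rw [Finset.sum_const, Finset.card_univ, Fintype.card_fin, nsmul_eq_mul,
    ENNReal.ofReal_mul (Nat.cast_nonneg _), ENNReal.ofReal_natCast]

/-- Regularity for almost every prior draw with an irrelevant source bounds the support of the
null prior. -/
lemma exists_ae_norm_sub_le_of_regularOn [IsProbabilityMeasure φ] {σ : ℝ} (hσ : 0 < σ)
    {V L : ℝ≥0} {U : Set (Vec d)} (hU : U ∈ 𝓝 θ₀)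
    (hreg : ∀ᵐ θ ∂(priorLaw φ θ₀ R), RegularOn σ φ V L U θ) {k : Fin K} (hk : k ∉ R) :
    ∃ b : ℝ, ∀ᵐ ϑ ∂φ, ‖ϑ - θ₀‖ ≤ b := by
  obtain ⟨δ, hδ, hball⟩ := Metric.nhds_basis_closedBall.mem_iff.1 hU
  have h1 := measurePreserving_eval_priorLaw (φ := φ) (θ₀ := θ₀) (R := R) k
  rw [if_neg hk] at h1
  refine ⟨L * σ ^ 2 + δ, ?_⟩
  rw [← h1.map_eq, ae_map_iff h1.aemeasurable
    (measurableSet_le (by fun_prop) measurable_const)]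
  filter_upwards [hreg] with θ hθ
  exact norm_sub_le_of_lipschitzOnWith_rho hσ hδ hball
    (fun ϑ hϑ => integrable_logLR_of_hasSubgaussianMGF ((hθ k).1 ϑ hϑ)) (hθ k).2

/-- Under regularity, the squared distances of the sources from the truth and the oracle error are
almost surely at most a multiple of `D̄² + d σ² / N`, with a constant that depends on the generative
model only. -/
lemma exists_ae_sq_norm_sub_le [IsProbabilityMeasure φ] {σ : ℝ} (hσ : 0 < σ)
    (hint : Integrable (fun ϑ => ‖ϑ - θ₀‖ ^ 2) φ) :
    ∃ A : ℝ, 0 ≤ A ∧ ∀ {K N₀ N : ℕ} {R : Finset (Fin K)} {V L : ℝ≥0} {U : Set (Vec d)} {rsep : ℝ},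
      0 < N₀ → 0 < N → U ∈ 𝓝 θ₀ → (∀ᵐ θ ∂(priorLaw φ θ₀ R), RegularOn σ φ V L U θ) → 0 < rsep →
      ∀ᵐ θ ∂(priorLaw φ θ₀ R), θ ∈ wellSeparated θ₀ R rsep →
        ∀ k, ‖θ k - θ₀‖ ^ 2 ≤ A * (nullMoment φ θ₀ + d * σ ^ 2 / N) ∧
          d * σ ^ 2 / (N₀ + N * R.card) ≤ A * (nullMoment φ θ₀ + d * σ ^ 2 / N) := by
  have hD : 0 ≤ nullMoment φ θ₀ := integral_nonneg fun ϑ => sq_nonneg _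
  -- With no irrelevant source, the existence of some `k` gives `N₀ + N |R| ≥ N`. The oracle bound
  -- is stated for each `k` so that it is void for `K = 0`, where it can fail.
  have huniv : ∀ {K N₀ N : ℕ} {R : Finset (Fin K)} {θ : Fin K → Vec d}, 0 < N →
      (∀ k, k ∈ R) → (∀ k ∈ R, θ k = θ₀) →
      ∀ k, ‖θ k - θ₀‖ ^ 2 ≤ 1 * (nullMoment φ θ₀ + d * σ ^ 2 / N) ∧
          d * σ ^ 2 / (N₀ + N * R.card) ≤ 1 * (nullMoment φ θ₀ + d * σ ^ 2 / N) := by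
    intro K N₀ N R θ hN hR hθ k
    have hN' : (0 : ℝ) < N := by exact_mod_cast hN
    have hRc : (1 : ℝ) ≤ R.card := by exact_mod_cast Finset.card_pos.2 ⟨k, hR k⟩
    have hle : (N : ℝ) ≤ N₀ + N * R.card := by nlinarith [Nat.cast_nonneg (α := ℝ) N₀]
    rw [hθ k (hR k), sub_self, norm_zero, one_mul, zero_pow two_ne_zero]
    refine ⟨by positivity, ?_⟩
    have : d * σ ^ 2 / (N₀ + N * R.card) ≤ d * σ ^ 2 / N := by gcongr
    linarith
  rcases hD.eq_or_lt with h0 | hpos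
  -- If `D̄² = 0`, the null prior sits at `θ₀`, so a draw is well separated only when every source
  -- is relevant.
  · refine ⟨1, zero_le_one, fun {K N₀ N R V L U rsep} hN₀ hN hU hreg hrsep => ?_⟩
    have hae : ∀ᵐ ϑ ∂φ, ‖ϑ - θ₀‖ = 0 := by
      have := (integral_eq_zero_iff_of_nonneg (fun ϑ => sq_nonneg _) hint).1 h0.symm
      filter_upwards [this] with ϑ hϑ
      exact pow_eq_zero_iff two_ne_zero |>.1 hϑ
    filter_upwards [ae_priorLaw_of_ae hae, ae_priorLaw_eq] with θ h1 h2 h3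
    refine huniv hN (fun k => ?_) h2
    by_contra hk
    have := h3 k hk
    rw [h1 k hk] at this
    linarith
  -- The explicit radius that regularity yields depends on `L` and `U`. Splitting on the mere
  -- existence of a bound makes `b` depend on `φ` and `θ₀` alone.
  by_cases hb : ∃ b : ℝ, ∀ᵐ ϑ ∂φ, ‖ϑ - θ₀‖ ≤ b
  · obtain ⟨b, hb⟩ := hb
    refine ⟨(b ^ 2 + d * σ ^ 2) / nullMoment φ θ₀, by positivity,
      fun {K N₀ N R V L U rsep} hN₀ hN hU hreg hrsep => ?_⟩
    have hN₀' : (1 : ℝ) ≤ N₀ := by exact_mod_cast hN₀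
    have hle : b ^ 2 + d * σ ^ 2
        ≤ (b ^ 2 + d * σ ^ 2) / nullMoment φ θ₀ * (nullMoment φ θ₀ + d * σ ^ 2 / N) := by
      rw [mul_add, div_mul_cancel₀ _ hpos.ne']
      exact le_add_of_nonneg_right (by positivity)
    filter_upwards [ae_priorLaw_of_ae hb, ae_priorLaw_eq] with θ h1 h2 _ k
    constructor
    · refine le_trans ?_ hle
      by_cases hk : k ∈ R
      · rw [h2 k hk, sub_self, norm_zero, zero_pow two_ne_zero]
        positivity
      · have := pow_le_pow_left₀ (norm_nonneg _) (h1 k hk) 2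
        have h3 : 0 ≤ d * σ ^ 2 := by positivity
        linarith
    · refine le_trans ?_ hle
      have h3 : d * σ ^ 2 / (N₀ + N * R.card) ≤ d * σ ^ 2 :=
        div_le_self (by positivity) (le_add_of_le_of_nonneg hN₀' (by positivity))
      nlinarith [sq_nonneg b]
  -- Unbounded support is incompatible with regularity at an irrelevant source, so all sources are
  -- relevant.
  · refine ⟨1, zero_le_one, fun {K N₀ N R V L U rsep} hN₀ hN hU hreg hrsep => ?_⟩
    filter_upwards [ae_priorLaw_eq] with θ h2 _
    refine huniv hN (fun k => ?_) h2
    by_contra hk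
    exact hb (exists_ae_norm_sub_le_of_regularOn hσ hU hreg hk)

end Prior

end ColdStart

/-! ### Assembly of the theorem. -/

theorem theorem1 :
    ∃ c₁ c₂ c₃ : ℝ, 0 < c₁ ∧ 0 < c₂ ∧ 0 < c₃ ∧
    -- the generative model
    ∀ (d : ℕ) (σ : ℝ) (θ₀ : ColdStart.Vec d) (φ : Measure (ColdStart.Vec d)),
      0 < σ → IsProbabilityMeasure φ → Integrable (fun ϑ => ‖ϑ - θ₀‖ ^ 2) φ →
    -- the constant in the two `O(·)` terms depends on the generative model only
    ∃ C : ℝ, 0 < C ∧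
    ∀ (K N₀ N : ℕ) (R : Finset (Fin K)) (p : Fin K → ℝ) (β rsep α Δ : ℝ) (V L : ℝ≥0)
      (U : Set (ColdStart.Vec d)) (θinit θlim : ColdStart.Data d K N₀ N → ColdStart.Vec d),
      0 < N₀ → 0 < N → (∀ k, 0 < p k ∧ p k < 1) → 0 < β → 0 < V → 0 < L →
    -- regularity on a neighbourhood of the truth that contains the basin
      U ∈ 𝓝 θ₀ → Metric.closedBall θ₀ (c₁ * Δ / L) ⊆ U →
      (∀ᵐ θ ∂(ColdStart.priorLaw φ θ₀ R), ColdStart.RegularOn σ φ V L U θ) →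
    -- probabilistic separation of the null prior
      0 < rsep → 0 ≤ α → α ≤ 1 → φ {ϑ | ‖ϑ - θ₀‖ < rsep} ≤ ENNReal.ofReal α →
    -- identifiability margin on the well-separated event
      0 < Δ →
      (∀ᵐ θ ∂(ColdStart.priorLaw φ θ₀ R), θ ∈ ColdStart.wellSeparated θ₀ R rsep →
        ColdStart.HasMargin σ φ θ₀ R Δ θ) →
    -- the initialization and the limit of the iterates are functions of the data
      Measurable θinit → Measurable θlim →
    -- the prior probability that the bound on the conditional error fails is at most `K α`
      ColdStart.priorLaw φ θ₀ R {θ | ¬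
        ∫⁻ ω in ColdStart.basinEvent σ φ β p θ₀ (c₁ * Δ / L) θinit θlim,
            ENNReal.ofReal (‖θlim ω - θ₀‖ ^ 2) ∂(ColdStart.dataLaw N₀ N σ θ₀ θ)
          ≤ ENNReal.ofReal
            (2 * d * σ ^ 2 / (N₀ + N * R.card)
              + C * ((K : ℝ) ^ 2 * ((N : ℝ) / N₀) ^ 2
                    * (ColdStart.nullMoment φ θ₀ + d * σ ^ 2 / N)
                    * Real.exp (2 * ColdStart.logitBound p))
                  * Real.exp (-(c₂ * β * N * Δ))
              + C * ((K : ℝ) ^ (5 / 2 : ℝ) * ((N : ℝ) / N₀) ^ 2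
                    * (ColdStart.nullMoment φ θ₀ + d * σ ^ 2 / N))
                  * Real.exp (-(c₃ * N * Δ ^ 2 / (V : ℝ) ^ 2)))}
        ≤ ENNReal.ofReal (K * α) := by
  -- `c₁` lets `rho` drift by half the margin, `c₂ = 2 · 1/4` comes from squaring the weight error,
  -- and `c₃` is half of `1/1024` because of Cauchy–Schwarz.
  refine ⟨1 / 2, 1 / 2, 1 / 2048, by norm_num, by norm_num, by norm_num, ?_⟩
  intro d σ θ₀ φ hσ hφ hint
  obtain ⟨M, hM0, hM⟩ := ColdStart.exists_lintegral_norm_pow_four_stdGaussian_le d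
  obtain ⟨H, hH0, hH⟩ := ColdStart.exists_stdGaussian_norm_tail_le d
  obtain ⟨A, hA0, hA⟩ := ColdStart.exists_ae_sq_norm_sub_le (θ₀ := θ₀) hσ hint
  refine ⟨6 * (2 * A + 1) + 6 * √(3 * (A ^ 2 + M + M * A ^ 2) * (2 + H)), by positivity, ?_⟩
  intro K N₀ N R p β rsep α Δ V L U θinit θlim hN₀ hN _ hβ hV hL hU hUball hreg hrsep _ _ hsep hΔ
    hmar _ _
  -- Up to a null set, the bound can fail only where the draw is not well separated.
  refine le_trans (measure_mono_ae ?_)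
    (ColdStart.priorLaw_compl_wellSeparated_le (R := R) hsep)
  filter_upwards [hA hN₀ hN hU hreg hrsep, hreg, hmar, ColdStart.ae_priorLaw_eq]
    with θ hAθ hregθ hmarθ hθ hbad hsepθ
  refine hbad ?_
  -- The fourth-moment bound needs `d ≥ 1`; for `d = 0` all errors vanish.
  rcases Nat.eq_zero_or_pos d with rfl | hd
  · have h0 : ∀ x : ColdStart.Vec 0, ‖x‖ = 0 := fun x => by rw [Subsingleton.elim x 0, norm_zero]
    simp [h0]
  have hD : 0 ≤ ColdStart.nullMoment φ θ₀ := integral_nonneg fun ϑ => sq_nonneg _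
  refine (ColdStart.setLIntegral_basinEvent_le hd hσ hN₀ hN hM0 hM hH0 hH θinit θlim hβ hΔ hV hL hU
    hUball hregθ (hmarθ hsepθ) hθ hA0 (le_add_of_nonneg_left hD) (fun k => (hAθ hsepθ k).1)
    (fun k => (hAθ hsepθ k).2)).trans (ENNReal.ofReal_le_ofReal ?_)
  refine (ColdStart.error_bound_le (c₂ := 1 / 2048 * N * Δ ^ 2 / (V : ℝ) ^ 2)
    (Nat.cast_nonneg K) (by positivity) hA0 hM0 hH0 (by ring)).trans (le_of_eq ?_)
  rw [← mul_div_assoc, mul_assoc 2 (d : ℝ), show 2 * (β * (N * Δ / 4)) = 1 / 2 * β * N * Δ by ring]
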